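/- Let $m\ge 1$ be an integer and let $q\ge 2$ be a power of $2$. Define the positive integer $M_m(q)$ as follows. *Case $q>2$.* If $m$ is odd with $2$-adic expansion $m=2^{i_1}+\cdots+2^{i_\ell}$ ($i_1<\cdots<i_\ell$), put $M_m(q)=\prod_{j=1}^{\ell}(q^{2^{i_j}}+1)$. If $m=2$, put $M_2(q)=q^2+1$. If $m\ge 4$ is even, let $\ell$ be the largest positive integer with $2^\ell+2^{\ell-1}\le m$ and put $M_m(q)=(q^{m-2^\ell+1}-1)(q^{2^\ell}-1)/(q-1)$. *Case $q=2$.* Let $\ell$ be the largest positive integer with $2^\ell-1\le m$, let $m_0=m-(2^\ell-1)$, and put $$M_m(2)=\begin{cases} 2^{m_0}(2^{2^\ell}-1)&\text{if } m_0\le 3,\\ (2^{2^{\ell-1}+m_0}-1)(2^{2^{\ell-1}}-1)&\text{if } 3<m_0<2^{\ell-1},\ m_0\text{ odd},\\ 2(2^{2^{\ell-1}+m_0-1}-1)(2^{2^{\ell-1}}-1)&\text{if } 3<m_0<2^{\ell-1},\ m_0\text{ even},\\ (2^{2^\ell}+1)(2^{2^{\ell-1}}-1)&\text{if } 3<m_0=2^{\ell-1},\\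 (2^{m_0}-1)(2^{2^\ell}-1)&\text{if } m_0>\max(3,2^{\ell-1}),\ m_0\text{ odd},\\ 2(2^{m_0-1}-1)(2^{2^\ell}-1)&\text{if } m_0>\max(3,2^{\ell-1}),\ m_0\text{ even}. \end{cases}$$ A signed partition of an integer $n\ge 0$ is a tuple $\wp=(d_1^{\varepsilon_1},\ldots,d_\ell^{\varepsilon_\ell})$ ($\ell\ge 0$), where the $d_i$ are positive integers with $d_1+\cdots+d_\ell=n$ and $\varepsilon_i\in\{-1,1\}$ for each $i$ (the empty tuple is the signed partition of $0$). For $m'\in\{0,\ldots,m\}$ and a signed partition $\wp=(d_1^{\varepsilon_1},\ldots,d_\ell^{\varepsilon_\ell})$ of $m-m'$, put $$L_{m,q}(m',\wp)=2^{\lceil\log_2(2m')\rceil}\,\mathrm{lcm}(q^{d_1}-\varepsilon_1,\ldots,q^{d_\ell}-\varepsilon_\ell),$$ where $2^{\lceil\log_2(2m')\rceil}$ is read as $1$ when $m'=0$, and the least common multiple of the empty tuple is $1$. **Theorem.** For every integer $m\ge 1$ and every power $q\ge 2$ of $2$, $$M_m(q)=\max\{L_{m,q}(m',\wp) : m'\in\{0,\ldots,m\},\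 \wp\text{ a signed partition of } m-m'\}.$$ -/

import Mathlib

/-- A signed partition `(d₁^ε₁, …, d_ℓ^ε_ℓ)` of `n`: an `ℓ`-tuple of positive integers `dᵢ` with
sum `n`, each carrying a sign `εᵢ ∈ {1, -1} = ℤˣ`. The tuple is recorded as the list of the pairs
`(dᵢ, εᵢ)`; the empty tuple is the only signed partition of `0`. -/
structure SignedPartition (n : ℕ) where
  /-- The list of the pairs `(dᵢ, εᵢ)`. -/
  parts : List (ℕ × ℤˣ)
  pos : ∀ p ∈ parts, 0 < p.1
  sum_eq : (parts.map Prod.fst).sum = n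

/-- The integer `q ^ d - ε`. It is nonnegative for `q ≥ 2`, and `natAbs` only turns it into a
natural number. -/
def signedFactor (q : ℕ) (p : ℕ × ℤˣ) : ℕ :=
  ((q : ℤ) ^ p.1 - (p.2 : ℤ)).natAbs

/-- `lcm (q ^ d₁ - ε₁, …, q ^ d_ℓ - ε_ℓ)`, which is `1` for the empty tuple. -/
def SignedPartition.lcm {n : ℕ} (q : ℕ) (P : SignedPartition n) : ℕ :=
  (P.parts.map (signedFactor q)).foldr Nat.lcm 1

/-- `2 ^ ⌈log₂ (2 m')⌉`, understood to be `1` when `m' = 0`.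
`Nat.clog 2 k` is the ceiling of the base `2` logarithm of `k ≥ 1`. -/
def twoPart (m' : ℕ) : ℕ :=
  if m' = 0 then 1 else 2 ^ Nat.clog 2 (2 * m')

/-- `L_{m,q}(m', P) = 2 ^ ⌈log₂ (2 m')⌉ * lcm (q ^ d₁ - ε₁, …, q ^ d_ℓ - ε_ℓ)`, for a signed
partition `P` of `m - m'`. -/
def orderL (m q m' : ℕ) (P : SignedPartition (m - m')) : ℕ :=
  twoPart m' * P.lcm q

/-- `M_m(q)` for `q > 2`. For odd `m` it is the product of `q ^ (2 ^ i) + 1` over the exponents `i`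
of the `2`-adic expansion of `m`. For even `m ≥ 4`, `l` is the largest positive integer with
`2 ^ l + 2 ^ (l - 1) ≤ m`; the division by `q - 1` is exact. -/
def maxOrderBig (m q : ℕ) : ℕ :=
  if Odd m then (m.bitIndices.map fun i => q ^ (2 ^ i) + 1).prod
  else if m = 2 then q ^ 2 + 1
  else
    let l := Nat.findGreatest (fun l => 1 ≤ l ∧ 2 ^ l + 2 ^ (l - 1) ≤ m) m
    (q ^ (m - 2 ^ l + 1) - 1) * (q ^ (2 ^ l) - 1) / (q - 1)

/-- `M_m(2)`, where `l` is the largest positive integer with `2 ^ l - 1 ≤ m` and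
`m₀ = m - (2 ^ l - 1)`. -/
def maxOrderTwo (m : ℕ) : ℕ :=
  let l := Nat.findGreatest (fun l => 1 ≤ l ∧ 2 ^ l - 1 ≤ m) m
  let m₀ := m - (2 ^ l - 1)
  if m₀ ≤ 3 then 2 ^ m₀ * (2 ^ (2 ^ l) - 1)
  else if m₀ < 2 ^ (l - 1) then
    if Odd m₀ then (2 ^ (2 ^ (l - 1) + m₀) - 1) * (2 ^ (2 ^ (l - 1)) - 1)
    else 2 * (2 ^ (2 ^ (l - 1) + m₀ - 1) - 1) * (2 ^ (2 ^ (l - 1)) - 1)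
  else if m₀ = 2 ^ (l - 1) then (2 ^ (2 ^ l) + 1) * (2 ^ (2 ^ (l - 1)) - 1)
  else
    if Odd m₀ then (2 ^ m₀ - 1) * (2 ^ (2 ^ l) - 1)
    else 2 * (2 ^ (m₀ - 1) - 1) * (2 ^ (2 ^ l) - 1)

/-- The function `M_m(q)`, for `m ≥ 1` and `q ≥ 2` a power of `2`. -/
def maxOrder (m q : ℕ) : ℕ :=
  if q = 2 then maxOrderTwo m else maxOrderBig m q

/-! Put x = 1/q and measure an order N by (1 - x) N / q^m. Since (1 - x)(1 + x)(1 + x^2)(1 + x^4)⋯ =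
1, the plus parts 1, 2, 4, … alone come close to measure 1, and the question is how little must be
lost when the parts have to fit into m.

Upper bound: a minus part 2^v c with c odd can be traded for the minus part c and the plus parts c,
2c, …, 2^(v-1) c, which have the same sum, without shrinking the lcm (`exists_plus_parts_of_minus`).
Two plus parts of equal 2-adic valuation j share the factor q^(2^j) + 1, which costs a factor q
(`exists_distinct_valuations`) and pushes the measure down to at most 1/2; no claimed maximum is
that small. There remain plus parts of distinct valuations, odd minus parts and a power of two. For
q ≥ 4, a second odd minus part (common factor q - 1) or any m' > 0 again halves the measure; for q =
2 only m' ≥ 4 does so.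

If 2^k is the first power of two missing among the plus parts, their measure is at most 1 - y + y^2
with y = x^(2^k) (`one_sub_mul_plusRatio_le_of_missing`). This bound improves with k, so a large
order needs a long run 1, 2, …, 2^(k-1); the size of m limits the run and leaves few rivals, which
are compared directly. For q ≥ 4, orders without minus part are controlled for odd m and m = 2 by
optimality of the binary expansion (`plusRatio_le_prod_bitIndices`).

The claimed values are attained because q is even: the factors used are pairwise coprime, so their
lcm is their product. -/

/-! ### Signed factors, lcms and coprimality -/

theorem signedFactor_one {q : ℕ} (hq : 1 ≤ q) (d : ℕ) : signedFactor q (d, 1) = q ^ d - 1 := by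
  have h : 1 ≤ q ^ d := Nat.one_le_pow _ _ hq
  simp only [signedFactor, Units.val_one]
  zify [h]
  rw [abs_of_nonneg]
  have : (1 : ℤ) ≤ (q : ℤ) ^ d := by exact_mod_cast h
  linarith

theorem signedFactor_neg_one (q d : ℕ) : signedFactor q (d, -1) = q ^ d + 1 := by
  simp only [signedFactor, Units.val_neg, Units.val_one, sub_neg_eq_add]
  norm_cast

theorem List.foldr_lcm_dvd_iff {L : List ℕ} {n : ℕ} :
    L.foldr Nat.lcm 1 ∣ n ↔ ∀ x ∈ L, x ∣ n := by
  induction L with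
  | nil => simp
  | cons a L ih => simp [Nat.lcm_dvd_iff, ih]

theorem List.dvd_foldr_lcm {L : List ℕ} {x : ℕ} (hx : x ∈ L) : x ∣ L.foldr Nat.lcm 1 :=
  List.foldr_lcm_dvd_iff.1 dvd_rfl x hx

theorem List.foldr_lcm_eq_prod {L : List ℕ} (h : L.Pairwise Nat.Coprime) :
    L.foldr Nat.lcm 1 = L.prod := by
  induction L with
  | nil => simp
  | cons a L ih =>
    rw [List.pairwise_cons] at h
    rw [List.foldr_cons, ih h.2, List.prod_cons]
    exact Nat.Coprime.lcm_eq_mul (Nat.coprime_list_prod_right_iff.2 h.1)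

/-- A common divisor divides the difference 2, and it is odd because q^n + 1 is. -/
theorem coprime_of_dvd_sub_one_of_dvd_add_one {q u v n : ℕ} (hq : Even q) (hn : 1 ≤ n)
    (hu : u ∣ q ^ n - 1) (hv : v ∣ q ^ n + 1) : u.Coprime v := by
  rcases Nat.eq_zero_or_pos q with rfl | hq0
  -- For q = 0 the truncated q^n - 1 is 0 and says nothing about u, but q^n + 1 = 1 forces v = 1.
  · have : u = 0 ∨ v ∣ 1 := by
      right; simpa [Nat.pos_iff_ne_zero.1 hn] using hv
    rcases this with rfl | h
    · simp_all [Nat.pos_iff_ne_zero.1 hn]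
    · rw [Nat.dvd_one.1 h]; exact Nat.coprime_one_right u
  have h1 : 1 ≤ q ^ n := Nat.one_le_pow _ _ hq0
  have hodd : Odd (q ^ n + 1) := (hq.pow_of_ne_zero (by omega)).add_one
  set g := u.gcd v
  have hg1 : g ∣ q ^ n - 1 := (Nat.gcd_dvd_left u v).trans hu
  have hg2 : g ∣ q ^ n + 1 := (Nat.gcd_dvd_right u v).trans hv
  have hg : g ∣ 2 := by
    have := Nat.dvd_sub hg2 hg1
    rwa [show q ^ n + 1 - (q ^ n - 1) = 2 by omega] at this
  rcases (Nat.dvd_prime Nat.prime_two).1 hg with h | h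
  · exact h
  · rw [h] at hg2
    exact absurd (even_iff_two_dvd.2 hg2) (Nat.not_even_iff_odd.2 hodd)

/-- Both numbers lift to the exponent ab: q^a - 1 divides q^(ab) - 1, and q^b + 1 divides q^(ab) + 1
because a is odd. -/
theorem coprime_pow_sub_one_pow_add_one {q a b : ℕ} (hq : Even q) (ha : Odd a) (hb : 1 ≤ b) :
    (q ^ a - 1).Coprime (q ^ b + 1) := by
  refine coprime_of_dvd_sub_one_of_dvd_add_one (n := a * b) hq (Nat.mul_pos ha.pos hb) ?_ ?_
  · simpa [pow_mul] using Nat.sub_dvd_pow_sub_pow (q ^ a) 1 b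
  · simpa [← pow_mul, mul_comm] using ha.nat_add_dvd_pow_add_pow (q ^ b) 1

theorem coprime_pow_two_pow_add_one {q i j : ℕ} (hq : Even q) (hij : i < j) :
    (q ^ 2 ^ i + 1).Coprime (q ^ 2 ^ j + 1) := by
  refine coprime_of_dvd_sub_one_of_dvd_add_one (n := 2 ^ j) hq Nat.one_le_two_pow ?_ dvd_rfl
  obtain ⟨k, rfl⟩ := Nat.exists_eq_add_of_lt hij
  have h : q ^ 2 ^ i + 1 ∣ (q ^ 2 ^ i) ^ 2 - 1 ^ 2 := ⟨_, Nat.sq_sub_sq _ _⟩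
  have h2 := Nat.sub_dvd_pow_sub_pow ((q ^ 2 ^ i) ^ 2) 1 (2 ^ k)
  rw [one_pow] at h h2
  rw [show q ^ 2 ^ (i + k + 1) = ((q ^ 2 ^ i) ^ 2) ^ 2 ^ k by
    rw [← pow_mul, ← pow_mul]; ring_nf]
  exact h.trans h2

/-! ### Orders that are attained -/

/-- The product of the `q ^ 2 ^ i + 1` over the list of exponents `S`. -/
def fermatProd (q : ℕ) (S : List ℕ) : ℕ := (S.map fun i => q ^ 2 ^ i + 1).prod

theorem fermatProd_range (q l : ℕ) :
    (q - 1) * fermatProd q (List.range l) = q ^ 2 ^ l - 1 := by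
  induction l with
  | zero => simp [fermatProd]
  | succ l ih =>
    have h : fermatProd q (List.range (l + 1))
        = fermatProd q (List.range l) * (q ^ 2 ^ l + 1) := by
      simp [fermatProd, List.range_succ]
    rw [h, ← mul_assoc, ih, pow_succ, pow_mul, mul_comm]
    simpa using (Nat.sq_sub_sq (q ^ 2 ^ l) 1).symm

/-- The orders `L_{m,q}(m', P)`. -/
def orderSet (m q : ℕ) : Set ℕ :=
  {N : ℕ | ∃ m' : ℕ, m' ≤ m ∧ ∃ P : SignedPartition (m - m'), N = orderL m q m' P}

/-- The plus parts `2 ^ i`, `i ∈ S`. -/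
def plusPowers (S : List ℕ) : List (ℕ × ℤˣ) := S.map fun i => (2 ^ i, -1)

theorem map_signedFactor_plusPowers (q : ℕ) (S : List ℕ) :
    (plusPowers S).map (signedFactor q) = S.map fun i => q ^ 2 ^ i + 1 := by
  simp [plusPowers, signedFactor_neg_one, Function.comp_def]

theorem sum_plusPowers (S : List ℕ) :
    ((plusPowers S).map Prod.fst).sum = (S.map fun i => 2 ^ i).sum := by
  simp [plusPowers, Function.comp_def]

theorem pos_of_mem_plusPowers {S : List ℕ} {p : ℕ × ℤˣ} (hp : p ∈ plusPowers S) : 0 < p.1 := by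
  simp only [plusPowers, List.mem_map] at hp
  obtain ⟨i, -, rfl⟩ := hp
  exact Nat.two_pow_pos i

theorem pairwise_coprime_fermat {q : ℕ} (hq : Even q) {S : List ℕ} (hS : S.Nodup) :
    (S.map fun i => q ^ 2 ^ i + 1).Pairwise Nat.Coprime := by
  rw [List.pairwise_map]
  refine hS.imp fun {i j} hij => ?_
  rcases lt_or_gt_of_ne hij with h | h
  · exact coprime_pow_two_pow_add_one hq h
  · exact (coprime_pow_two_pow_add_one hq h).symm

theorem plus_mem_orderSet {m q m' : ℕ} (hq : Even q) {S : List ℕ} (hS : S.Nodup)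
    (hsum : m' + (S.map fun i => 2 ^ i).sum = m) :
    twoPart m' * fermatProd q S ∈ orderSet m q := by
  refine ⟨m', by omega, ⟨plusPowers S, fun p hp => pos_of_mem_plusPowers hp, ?_⟩, ?_⟩
  · rw [sum_plusPowers]; omega
  · rw [orderL, SignedPartition.lcm, map_signedFactor_plusPowers,
      List.foldr_lcm_eq_prod (pairwise_coprime_fermat hq hS), fermatProd]

theorem minus_plus_mem_orderSet {m q m' a : ℕ} (hq : Even q) (hq1 : 1 ≤ q) (ha : Odd a)
    {S : List ℕ} (hS : S.Nodup) (hsum : m' + a + (S.map fun i => 2 ^ i).sum = m) :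
    twoPart m' * ((q ^ a - 1) * fermatProd q S) ∈ orderSet m q := by
  refine ⟨m', by omega, ⟨(a, 1) :: plusPowers S, ?_, ?_⟩, ?_⟩
  · intro p hp
    rcases List.mem_cons.1 hp with rfl | hp
    · exact ha.pos
    · exact pos_of_mem_plusPowers hp
  · rw [List.map_cons, List.sum_cons, sum_plusPowers]; simp only; omega
  · rw [orderL, SignedPartition.lcm, List.map_cons, map_signedFactor_plusPowers,
      signedFactor_one hq1, List.foldr_lcm_eq_prod, List.prod_cons, fermatProd]
    refine List.pairwise_cons.2 ⟨?_, pairwise_coprime_fermat hq hS⟩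
    intro x hx
    obtain ⟨i, -, rfl⟩ := List.mem_map.1 hx
    exact coprime_pow_sub_one_pow_add_one hq ha Nat.one_le_two_pow

theorem sum_two_pow_range (l : ℕ) : ((List.range l).map fun i => 2 ^ i).sum = 2 ^ l - 1 := by
  induction l with
  | zero => simp
  | succ l ih =>
    have := Nat.one_le_two_pow (n := l)
    rw [List.range_succ, List.map_append, List.sum_append, ih, pow_succ]
    simp only [List.map_cons, List.map_nil, List.sum_cons, List.sum_nil]
    omega

/-! ### Reduction to odd minus parts -/

/-- The least common multiple of the `q ^ a - 1`, `a ∈ A`. -/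
def lcmMinus (q : ℕ) (A : List ℕ) : ℕ := (A.map fun a => q ^ a - 1).foldr Nat.lcm 1

/-- The least common multiple of the `q ^ b + 1`, `b ∈ B`. -/
def lcmPlus (q : ℕ) (B : List ℕ) : ℕ := (B.map fun b => q ^ b + 1).foldr Nat.lcm 1

theorem lcmPlus_dvd_of_subset {q : ℕ} {B C : List ℕ} (h : B ⊆ C) : lcmPlus q B ∣ lcmPlus q C :=
  List.foldr_lcm_dvd_iff.2 fun _ hx => List.dvd_foldr_lcm (List.map_subset _ h hx)

theorem lcmPlus_pos (q : ℕ) (B : List ℕ) : 0 < lcmPlus q B := by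
  induction B with
  | nil => simp [lcmPlus]
  | cons b B ih => exact Nat.lcm_pos (Nat.succ_pos (q ^ b)) ih

theorem lcmMinus_dvd_of_subset {q : ℕ} {B C : List ℕ} (h : B ⊆ C) : lcmMinus q B ∣ lcmMinus q C :=
  List.foldr_lcm_dvd_iff.2 fun _ hx => List.dvd_foldr_lcm (List.map_subset _ h hx)

/-- Factor q^(2^v c) - 1 = (q^c - 1)(q^c + 1)(q^(2c) + 1)⋯(q^(2^(v-1) c) + 1); the exponents on the
right sum to 2^v c. -/
theorem exists_plus_parts_of_minus {q : ℕ} (hq : Even q) {c : ℕ} (hc : 1 ≤ c) (v : ℕ) :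
    ∃ B : List ℕ, (∀ b ∈ B, 0 < b) ∧ c + B.sum = 2 ^ v * c ∧
      q ^ (2 ^ v * c) - 1 ∣ Nat.lcm (q ^ c - 1) (lcmPlus q B) := by
  induction v with
  | zero => exact ⟨[], by simp, by simp, by simp [lcmPlus]⟩
  | succ v ih =>
    obtain ⟨B, hB, hsum, hdvd⟩ := ih
    have hpos : 0 < 2 ^ v * c := by positivity
    refine ⟨(2 ^ v * c) :: B, ?_, ?_, ?_⟩
    · intro b hb
      rcases List.mem_cons.1 hb with rfl | hb
      · exact hpos
      · exact hB b hb
    · rw [List.sum_cons, pow_succ]; linarith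
    · have h : q ^ (2 ^ (v + 1) * c) - 1 = (q ^ (2 ^ v * c) + 1) * (q ^ (2 ^ v * c) - 1) := by
        rw [← Nat.sq_sub_sq, one_pow, ← pow_mul]
        ring_nf
      rw [h]
      refine Nat.Coprime.mul_dvd_of_dvd_of_dvd
        (coprime_of_dvd_sub_one_of_dvd_add_one hq hpos dvd_rfl dvd_rfl).symm ?_ ?_
      · exact (List.dvd_foldr_lcm (by simp)).trans (Nat.dvd_lcm_right _ _)
      · exact hdvd.trans (lcm_dvd_lcm dvd_rfl (lcmPlus_dvd_of_subset (by simp)))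

theorem exists_odd_minus_parts {q : ℕ} (hq : Even q) (hq1 : 1 ≤ q) (L : List (ℕ × ℤˣ))
    (hL : ∀ p ∈ L, 0 < p.1) :
    ∃ A B : List ℕ, (∀ a ∈ A, Odd a) ∧ (∀ b ∈ B, 0 < b) ∧
      A.sum + B.sum = (L.map Prod.fst).sum ∧
      (L.map (signedFactor q)).foldr Nat.lcm 1 ∣ Nat.lcm (lcmMinus q A) (lcmPlus q B) := by
  induction L with
  | nil => exact ⟨[], [], by simp, by simp, by simp, by simp⟩
  | cons p L ih =>
    obtain ⟨A, B, hA, hB, hsum, hdvd⟩ := ih fun p hp => hL p (List.mem_cons_of_mem _ hp)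
    obtain ⟨d, ε⟩ := p
    have hd : 0 < d := hL (d, ε) (by simp)
    rcases Int.units_eq_one_or ε with rfl | rfl
    · obtain ⟨v, c, hc, rfl⟩ := Nat.exists_eq_two_pow_mul_odd hd.ne'
      obtain ⟨B', hB', hsum', hdvd'⟩ := exists_plus_parts_of_minus hq hc.pos v
      refine ⟨c :: A, B' ++ B, ?_, ?_, ?_, ?_⟩
      · intro a ha
        rcases List.mem_cons.1 ha with rfl | ha
        · exact hc
        · exact hA a ha
      · intro b hb
        rcases List.mem_append.1 hb with hb | hb
        · exact hB' b hb
        · exact hB b hb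
      · simp only [List.sum_cons, List.sum_append, List.map_cons]; omega
      · rw [List.map_cons, List.foldr_cons, signedFactor_one hq1]
        refine Nat.lcm_dvd (hdvd'.trans (lcm_dvd_lcm ?_ (lcmPlus_dvd_of_subset (by simp))))
          (hdvd.trans (lcm_dvd_lcm (lcmMinus_dvd_of_subset (by simp))
            (lcmPlus_dvd_of_subset (by simp))))
        exact List.dvd_foldr_lcm (by simp)
    · refine ⟨A, d :: B, hA, ?_, ?_, ?_⟩
      · intro b hb
        rcases List.mem_cons.1 hb with rfl | hb
        · exact hd
        · exact hB b hb
      · simp only [List.sum_cons, List.map_cons]; omega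
      · rw [List.map_cons, List.foldr_cons, signedFactor_neg_one]
        refine Nat.lcm_dvd ((List.dvd_foldr_lcm (by simp)).trans (Nat.dvd_lcm_right _ _))
          (hdvd.trans (lcm_dvd_lcm dvd_rfl (lcmPlus_dvd_of_subset (by simp))))

/-! ### Plus parts of distinct valuations -/

/-- The positive integer with `2`-adic valuation `i` and odd part `2 * o i + 1`. -/
def valPart (o : ℕ → ℕ) (i : ℕ) : ℕ := 2 ^ i * (2 * o i + 1)

/-- `∏ (1 + x ^ d)` over the integers `d = valPart o i` with `i ∈ S`. -/
noncomputable def plusRatio (x : ℝ) (S : Finset ℕ) (o : ℕ → ℕ) : ℝ :=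
  ∏ i ∈ S, (1 + x ^ valPart o i)

theorem two_pow_le_valPart (o : ℕ → ℕ) (i : ℕ) : 2 ^ i ≤ valPart o i :=
  Nat.le_mul_of_pos_right _ (by omega)

theorem valPart_pos (o : ℕ → ℕ) (i : ℕ) : 0 < valPart o i :=
  lt_of_lt_of_le (by positivity) (two_pow_le_valPart o i)

theorem plusRatio_pos {x : ℝ} (hx : 0 ≤ x) (S : Finset ℕ) (o : ℕ → ℕ) : 0 < plusRatio x S o :=
  Finset.prod_pos fun _ _ => by positivity

/-- A list of plus parts is bounded by a family of parts with distinct `2`-adic valuations; a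
repeated valuation costs a factor `q`. -/
theorem exists_distinct_valuations {q : ℕ} (hq : 2 ≤ q) (B : List ℕ) (hB : ∀ b ∈ B, 0 < b) :
    ∃ (S : Finset ℕ) (o : ℕ → ℕ), (∀ i ∈ S, valPart o i ∈ B) ∧
      ((∑ i ∈ S, valPart o i = B.sum ∧
          (lcmPlus q B : ℝ) ≤ (q : ℝ) ^ B.sum * plusRatio (q : ℝ)⁻¹ S o) ∨
        (lcmPlus q B : ℝ) * q ≤ (q : ℝ) ^ B.sum * plusRatio (q : ℝ)⁻¹ S o) := by
  have hq0 : (0 : ℝ) < q := by positivity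
  have hq1 : (1 : ℝ) ≤ q := by exact_mod_cast (by omega : 1 ≤ q)
  induction B with
  | nil => exact ⟨∅, fun _ => 0, by simp, by simp [lcmPlus, plusRatio]⟩
  | cons b B ih =>
    obtain ⟨S, o, hS, h⟩ := ih fun p hp => hB p (List.mem_cons_of_mem _ hp)
    have hb : 0 < b := hB b (by simp)
    have hcons : lcmPlus q (b :: B) = Nat.lcm (q ^ b + 1) (lcmPlus q B) := rfl
    obtain ⟨j, c', hc, hbj⟩ := Nat.exists_eq_two_pow_mul_odd hb.ne'
    obtain ⟨c, rfl⟩ := hc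
    by_cases hj : j ∈ S
    · refine ⟨S, o, fun i hi => List.mem_cons_of_mem _ (hS i hi), Or.inr ?_⟩
      -- The new part and the part already recorded at j are both odd multiples of 2^j, so q^(2^j) +
      -- 1 ≥ q + 1 divides the gcd.
      have hle : (q + 1) * lcmPlus q (b :: B) ≤ (q ^ b + 1) * lcmPlus q B := by
        rw [hcons, ← Nat.gcd_mul_lcm (q ^ b + 1) (lcmPlus q B)]
        refine Nat.mul_le_mul_right _ (le_trans ?_
          (Nat.le_of_dvd (Nat.gcd_pos_of_pos_left _ (Nat.succ_pos _)) (Nat.dvd_gcd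
            (?_ : q ^ 2 ^ j + 1 ∣ _) (dvd_trans ?_ (List.dvd_foldr_lcm
              (List.mem_map_of_mem (hS j hj)))))))
        · exact Nat.succ_le_succ (Nat.le_self_pow (by positivity) q)
        · rw [hbj, pow_mul]
          simpa using (odd_two_mul_add_one c).nat_add_dvd_pow_add_pow (q ^ 2 ^ j) 1
        · rw [valPart, pow_mul]
          simpa using (odd_two_mul_add_one (o j)).nat_add_dvd_pow_add_pow (q ^ 2 ^ j) 1
      have hle' : ((q : ℝ) + 1) * lcmPlus q (b :: B) ≤ ((q : ℝ) ^ b + 1) * lcmPlus q B := by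
        exact_mod_cast hle
      have hqb : (q : ℝ) ≤ (q : ℝ) ^ b := le_self_pow₀ hq1 hb.ne'
      have h1 : (lcmPlus q (b :: B) : ℝ) * q ≤ (q : ℝ) ^ b * lcmPlus q B := by
        -- The loss q + 1 also pays for replacing q^b + 1 by q^b, since q (q^b + 1) ≤ (q + 1) q^b
        -- when q ≤ q^b; a factor q is left.
        have h2 : (q : ℝ) * (((q : ℝ) + 1) * lcmPlus q (b :: B))
            ≤ (q + 1) * ((q : ℝ) ^ b * lcmPlus q B) := by
          have h3 : (q : ℝ) * (((q : ℝ) ^ b + 1) * lcmPlus q B)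
              ≤ (q + 1) * ((q : ℝ) ^ b * lcmPlus q B) := by
            have : (0 : ℝ) ≤ lcmPlus q B := by positivity
            nlinarith
          exact (mul_le_mul_of_nonneg_left hle' hq0.le).trans h3
        refine le_of_mul_le_mul_left (a := (q : ℝ) + 1) ?_ (by positivity)
        linarith
      have h2 : (lcmPlus q B : ℝ) ≤ (q : ℝ) ^ B.sum * plusRatio (q : ℝ)⁻¹ S o := by
        rcases h with h | h
        · exact h.2
        · exact (le_mul_of_one_le_right (by positivity) hq1).trans h
      rw [List.sum_cons, pow_add, mul_assoc]
      exact h1.trans (mul_le_mul_of_nonneg_left h2 (by positivity))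
    · have hoj : ∀ i ∈ S, valPart (Function.update o j c) i = valPart o i := by
        intro i hi
        rw [valPart, valPart, Function.update_of_ne (ne_of_mem_of_not_mem hi hj)]
      have hjj : valPart (Function.update o j c) j = b := by
        rw [valPart, Function.update_self, hbj]
      have hr : plusRatio (q : ℝ)⁻¹ (insert j S) (Function.update o j c)
          = (1 + (q : ℝ)⁻¹ ^ b) * plusRatio (q : ℝ)⁻¹ S o := by
        rw [plusRatio, Finset.prod_insert hj, hjj, plusRatio]
        congr 1
        exact Finset.prod_congr rfl fun i hi => by rw [hoj i hi]
      have hb1 : (q : ℝ) ^ b + 1 = (q : ℝ) ^ b * (1 + (q : ℝ)⁻¹ ^ b) := by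
        rw [mul_add, ← mul_pow, mul_inv_cancel₀ hq0.ne', one_pow, mul_one]
      have hlcm : (lcmPlus q (b :: B) : ℝ) ≤ ((q : ℝ) ^ b + 1) * lcmPlus q B := by
        rw [hcons]
        exact_mod_cast Nat.lcm_le_mul (Nat.succ_pos _) (lcmPlus_pos q B)
      refine ⟨insert j S, Function.update o j c, ?_, ?_⟩
      · intro i hi
        rcases Finset.mem_insert.1 hi with rfl | hi
        · rw [hjj]; simp
        · rw [hoj i hi]; exact List.mem_cons_of_mem _ (hS i hi)
      · rw [hr, Finset.sum_insert hj, hjj, Finset.sum_congr rfl hoj, List.sum_cons, pow_add]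
        have hmul : ∀ t : ℝ, (q : ℝ) ^ b * t * ((1 + (q : ℝ)⁻¹ ^ b) * plusRatio (q : ℝ)⁻¹ S o)
            = ((q : ℝ) ^ b + 1) * (t * plusRatio (q : ℝ)⁻¹ S o) := by
          intro t; rw [hb1]; ring
        rw [hmul]
        rcases h with ⟨h1, h2⟩ | h2
        · exact Or.inl ⟨congrArg (b + ·) h1, hlcm.trans (mul_le_mul_of_nonneg_left h2 (by positivity))⟩
        · refine Or.inr ((mul_le_mul_of_nonneg_right hlcm hq0.le).trans ?_)
          rw [mul_assoc]
          exact mul_le_mul_of_nonneg_left h2 (by positivity)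

/-! ### Telescoping bounds for the plus parts -/

theorem pow_two_pow_succ (x : ℝ) (k : ℕ) : x ^ 2 ^ (k + 1) = (x ^ 2 ^ k) ^ 2 := by
  rw [← pow_mul, pow_succ]

theorem plusRatio_eq_mul_erase {x : ℝ} {S : Finset ℕ} {k : ℕ} (hk : k ∈ S) (o : ℕ → ℕ) :
    plusRatio x S o = (1 + x ^ valPart o k) * plusRatio x (S.erase k) o :=
  (Finset.mul_prod_erase S _ hk).symm

/-- A part of valuation i is at least 2^i, so the product is dominated by ∏ (1 + x^(2^i)) over i ≥
k, which telescopes through (1 - y)(1 + y) = 1 - y^2. -/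
theorem one_sub_mul_plusRatio_le {x : ℝ} (hx : 0 ≤ x) (hx1 : x ≤ 1) (o : ℕ → ℕ)
    {S : Finset ℕ} {k : ℕ} (hS : ∀ i ∈ S, k ≤ i) :
    (1 - x ^ 2 ^ k) * plusRatio x S o ≤ 1 := by
  obtain ⟨n, hn⟩ : ∃ n, ∀ i ∈ S, i < k + n :=
    ⟨S.sup id + 1, fun i hi => by
      have : i ≤ S.sup id := Finset.le_sup (f := id) hi
      omega⟩
  induction n generalizing k S with
  | zero =>
    have : S = ∅ := Finset.eq_empty_of_forall_notMem fun i hi => by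
      have := hS i hi; have := hn i hi; omega
    subst this
    have : 0 ≤ x ^ 2 ^ k := by positivity
    simpa [plusRatio] using this
  | succ n ih =>
    have hy0 : 0 ≤ x ^ 2 ^ k := by positivity
    have hy1 : x ^ 2 ^ k ≤ 1 := pow_le_one₀ hx hx1
    by_cases hk : k ∈ S
    · rw [plusRatio_eq_mul_erase hk]
      have hρ := plusRatio_pos hx (S.erase k) o
      have h := @ih (S.erase k) (k + 1)
        (fun i hi => by
          have := hS i (Finset.mem_of_mem_erase hi)
          have := Finset.ne_of_mem_erase hi
          omega)
        (fun i hi => by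
          have := hn i (Finset.mem_of_mem_erase hi)
          omega)
      rw [pow_two_pow_succ] at h
      have hle : x ^ valPart o k ≤ x ^ 2 ^ k :=
        pow_le_pow_of_le_one hx hx1 (two_pow_le_valPart o k)
      calc (1 - x ^ 2 ^ k) * ((1 + x ^ valPart o k) * plusRatio x (S.erase k) o)
          ≤ (1 - x ^ 2 ^ k) * ((1 + x ^ 2 ^ k) * plusRatio x (S.erase k) o) := by
            refine mul_le_mul_of_nonneg_left ?_ (by linarith)
            exact mul_le_mul_of_nonneg_right (by linarith) hρ.le
        _ = (1 - (x ^ 2 ^ k) ^ 2) * plusRatio x (S.erase k) o := by ring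
        _ ≤ 1 := h
    · have hρ := plusRatio_pos hx S o
      have h := @ih S (k + 1)
        (fun i hi => by
          have := hS i hi
          have : i ≠ k := ne_of_mem_of_not_mem hi hk
          omega)
        (fun i hi => by
          have := hn i hi
          omega)
      rw [pow_two_pow_succ] at h
      nlinarith [mul_nonneg (mul_nonneg hy0 (sub_nonneg.2 hy1)) hρ.le]

/-- A part of valuation k other than 2^k is at least 3·2^k, whence the cube; the remaining
valuations telescope from k + 1. -/
theorem one_sub_sq_mul_plusRatio_le {x : ℝ} (hx : 0 ≤ x) (hx1 : x ≤ 1) {o : ℕ → ℕ}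
    {S : Finset ℕ} {k : ℕ} (hS : ∀ i ∈ S, k ≤ i) (hk : k ∈ S → o k ≠ 0) :
    (1 - (x ^ 2 ^ k) ^ 2) * plusRatio x S o ≤ 1 + (x ^ 2 ^ k) ^ 3 := by
  have hy0 : 0 ≤ x ^ 2 ^ k := by positivity
  rw [← pow_two_pow_succ]
  by_cases hkS : k ∈ S
  · rw [plusRatio_eq_mul_erase hkS]
    have h := one_sub_mul_plusRatio_le hx hx1 o (S := S.erase k) (k := k + 1) (fun i hi => by
      have := hS i (Finset.mem_of_mem_erase hi)
      have := Finset.ne_of_mem_erase hi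
      omega)
    have hle : x ^ valPart o k ≤ (x ^ 2 ^ k) ^ 3 := by
      rw [← pow_mul]
      refine pow_le_pow_of_le_one hx hx1 (Nat.mul_le_mul_left _ ?_)
      have := hk hkS
      omega
    calc (1 - x ^ 2 ^ (k + 1)) * ((1 + x ^ valPart o k) * plusRatio x (S.erase k) o)
        = (1 + x ^ valPart o k) * ((1 - x ^ 2 ^ (k + 1)) * plusRatio x (S.erase k) o) := by ring
      _ ≤ (1 + x ^ valPart o k) * 1 := mul_le_mul_of_nonneg_left h (by positivity)
      _ ≤ 1 + (x ^ 2 ^ k) ^ 3 := by linarith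
  · have h := one_sub_mul_plusRatio_le hx hx1 o (S := S) (k := k + 1) (fun i hi => by
      have := hS i hi
      have : i ≠ k := ne_of_mem_of_not_mem hi hkS
      omega)
    have : 0 ≤ (x ^ 2 ^ k) ^ 3 := by positivity
    linarith

theorem valPart_of_eq_zero {o : ℕ → ℕ} {i : ℕ} (h : o i = 0) : valPart o i = 2 ^ i := by
  simp [valPart, h]

/-- Split off the parts `1, 2, …, 2 ^ (k - 1)`. -/
theorem one_sub_mul_plusRatio_eq {x : ℝ} {o : ℕ → ℕ} {S : Finset ℕ} {k : ℕ}
    (hk : ∀ i < k, i ∈ S ∧ o i = 0) :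
    (1 - x) * plusRatio x S o = (1 - x ^ 2 ^ k) * plusRatio x (S.filter (k ≤ ·)) o ∧
      ∑ i ∈ S, valPart o i = 2 ^ k - 1 + ∑ i ∈ S.filter (k ≤ ·), valPart o i := by
  induction k with
  | zero => simp
  | succ k ih =>
    obtain ⟨h1, h2⟩ := ih fun i hi => hk i (by omega)
    obtain ⟨hkS, hok⟩ := hk k (by omega)
    have hmem : k ∈ S.filter (k ≤ ·) := by simp [hkS]
    have herase : (S.filter (k ≤ ·)).erase k = S.filter (k + 1 ≤ ·) := by
      ext i
      simp only [Finset.mem_erase, Finset.mem_filter]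
      constructor
      · rintro ⟨h, h', h''⟩; exact ⟨h', by omega⟩
      · rintro ⟨h', h''⟩; exact ⟨by omega, h', by omega⟩
    constructor
    · rw [h1, plusRatio_eq_mul_erase hmem, herase, valPart_of_eq_zero hok, pow_two_pow_succ]
      ring
    · rw [h2, ← Finset.add_sum_erase _ _ hmem, herase, valPart_of_eq_zero hok, pow_succ]
      have := Nat.one_le_two_pow (n := k)
      omega

theorem exists_first_missing (S : Finset ℕ) (o : ℕ → ℕ) :
    ∃ k, (∀ i < k, i ∈ S ∧ o i = 0) ∧ (k ∈ S → o k ≠ 0) := by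
  classical
  have h : ∃ k, ¬(k ∈ S ∧ o k = 0) := by
    obtain ⟨k, hk⟩ := Infinite.exists_notMem_finset S
    exact ⟨k, fun h => hk h.1⟩
  refine ⟨Nat.find h, fun i hi => not_not.1 (Nat.find_min h hi), fun hk h0 => ?_⟩
  exact Nat.find_spec h ⟨hk, h0⟩

/-- The run below k telescopes to 1 - y with y = x^(2^k). The rest is at most (1 + y^3)/(1 - y^2),
and 1 + y^3 = (1 + y)(1 - y + y^2). -/
theorem one_sub_mul_plusRatio_le_of_missing {x : ℝ} (hx : 0 ≤ x) (hx1 : x < 1) {o : ℕ → ℕ}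
    {S : Finset ℕ} {k : ℕ} (hk : ∀ i < k, i ∈ S ∧ o i = 0) (hk' : k ∈ S → o k ≠ 0) :
    (1 - x) * plusRatio x S o ≤ 1 - x ^ 2 ^ k + (x ^ 2 ^ k) ^ 2 := by
  rw [(one_sub_mul_plusRatio_eq hk).1]
  have h := one_sub_sq_mul_plusRatio_le hx hx1.le (S := S.filter (k ≤ ·)) (o := o) (k := k)
    (fun i hi => (Finset.mem_filter.1 hi).2) (fun h => hk' (Finset.mem_filter.1 h).1)
  have hy0 : 0 ≤ x ^ 2 ^ k := by positivity
  refine le_of_mul_le_mul_left (a := 1 + x ^ 2 ^ k) ?_ (by positivity)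
  linear_combination h

theorem two_pow_succ_le_valPart {o : ℕ → ℕ} {i k : ℕ} (hi : k ≤ i) (hk : i = k → o i ≠ 0) :
    2 ^ (k + 1) ≤ valPart o i := by
  rcases hi.eq_or_lt with rfl | h
  · rw [pow_succ]
    have := hk rfl
    exact Nat.mul_le_mul_left _ (by omega)
  · exact (Nat.pow_le_pow_right (by norm_num) h).trans (two_pow_le_valPart o i)

theorem odd_sum_valPart_iff (S : Finset ℕ) (o : ℕ → ℕ) :
    Odd (∑ i ∈ S, valPart o i) ↔ 0 ∈ S := by
  have heven : ∀ T : Finset ℕ, 0 ∉ T → Even (∑ i ∈ T, valPart o i) := by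
    intro T hT
    rw [even_iff_two_dvd]
    refine Finset.dvd_sum fun i hi => ?_
    have : i ≠ 0 := ne_of_mem_of_not_mem hi hT
    exact (dvd_pow_self 2 this).trans (Dvd.intro _ rfl)
  constructor
  · intro h
    by_contra h0
    exact (Nat.not_even_iff_odd.2 h) (heven S h0)
  · intro h
    rw [← Finset.add_sum_erase _ _ h]
    exact Odd.add_even ⟨o 0, by simp [valPart]⟩ (heven _ (by simp))

/-! ### Sizes of the power of two and of the minus parts -/

theorem twoPart_le {m' : ℕ} : twoPart m' ≤ 2 ^ m' := by
  unfold twoPart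
  split_ifs with h
  · simp [h]
  · refine Nat.pow_le_pow_right (by norm_num) (Nat.clog_le_of_le_pow ?_)
    obtain ⟨n, rfl⟩ := Nat.exists_eq_succ_of_ne_zero h
    have := Nat.lt_two_pow_self (n := n)
    rw [pow_succ]
    omega

theorem two_mul_twoPart_le {m' : ℕ} (h : 4 ≤ m') : 2 * twoPart m' ≤ 2 ^ m' := by
  unfold twoPart
  rw [if_neg (by omega), ← pow_succ']
  refine Nat.pow_le_pow_right (by norm_num) ?_
  obtain ⟨n, rfl⟩ := Nat.exists_eq_add_of_le h
  have : Nat.clog 2 (2 * (4 + n)) ≤ 3 + n := by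
    refine Nat.clog_le_of_le_pow ?_
    have := Nat.lt_two_pow_self (n := n)
    rw [pow_add]
    omega
  omega

theorem lcmMinus_cons (q a : ℕ) (A : List ℕ) :
    lcmMinus q (a :: A) = Nat.lcm (q ^ a - 1) (lcmMinus q A) := rfl

theorem lcmMinus_pos {q : ℕ} (hq : 2 ≤ q) {A : List ℕ} (hA : ∀ a ∈ A, Odd a) :
    0 < lcmMinus q A := by
  induction A with
  | nil => simp [lcmMinus]
  | cons a A ih =>
    rw [lcmMinus_cons]
    refine Nat.lcm_pos ?_ (ih fun b hb => hA b (List.mem_cons_of_mem _ hb))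
    have := Nat.one_lt_pow (hA a (by simp)).pos.ne' (by omega : 1 < q)
    omega

theorem lcmMinus_le {q : ℕ} (hq : 2 ≤ q) {A : List ℕ} (hA : ∀ a ∈ A, Odd a) :
    lcmMinus q A ≤ q ^ A.sum := by
  induction A with
  | nil => simp [lcmMinus]
  | cons a A ih =>
    have hA' : ∀ a ∈ A, Odd a := fun b hb => hA b (List.mem_cons_of_mem _ hb)
    have hpos : 1 < q ^ a := Nat.one_lt_pow (hA a (by simp)).pos.ne' (by omega)
    rw [lcmMinus_cons, List.sum_cons, pow_add]
    refine (Nat.lcm_le_mul (by omega) (lcmMinus_pos hq hA')).trans ?_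
    exact Nat.mul_le_mul (by omega) (ih hA')

theorem lcmMinus_cons_le {q : ℕ} (hq : 2 ≤ q) {a : ℕ} {A : List ℕ} (hA : ∀ b ∈ a :: A, Odd b) :
    (lcmMinus q (a :: A) : ℝ) ≤ (q : ℝ) ^ (a :: A).sum * (1 - (q : ℝ)⁻¹ ^ a) := by
  have hA' : ∀ a ∈ A, Odd a := fun b hb => hA b (List.mem_cons_of_mem _ hb)
  have hpos : 1 < q ^ a := Nat.one_lt_pow (hA a (by simp)).pos.ne' (by omega)
  have h : lcmMinus q (a :: A) ≤ (q ^ a - 1) * q ^ A.sum := by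
    rw [lcmMinus_cons]
    refine (Nat.lcm_le_mul (by omega) (lcmMinus_pos hq hA')).trans ?_
    exact Nat.mul_le_mul_left _ (lcmMinus_le hq hA')
  have h' : (lcmMinus q (a :: A) : ℝ) ≤ ((q ^ a - 1 : ℕ) : ℝ) * (q : ℝ) ^ A.sum := by
    exact_mod_cast h
  rw [Nat.cast_sub hpos.le, Nat.cast_pow, Nat.cast_one] at h'
  have hq0 : (q : ℝ) ≠ 0 := by positivity
  have e : (q : ℝ) ^ a * (q : ℝ)⁻¹ ^ a = 1 := by rw [← mul_pow, mul_inv_cancel₀ hq0, one_pow]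
  refine h'.trans (le_of_eq ?_)
  rw [List.sum_cons, pow_add]
  linear_combination (q : ℝ) ^ A.sum * e

/-- Any two minus factors share q - 1. This is a real loss only for q > 2. -/
theorem sub_one_mul_lcmMinus_le {q : ℕ} (hq : 2 ≤ q) {a b : ℕ} {A : List ℕ}
    (hA : ∀ c ∈ a :: b :: A, Odd c) :
    (q - 1) * lcmMinus q (a :: b :: A) ≤ q ^ (a :: b :: A).sum := by
  have hA' : ∀ c ∈ b :: A, Odd c := fun c hc => hA c (List.mem_cons_of_mem _ hc)
  have hpos : 1 < q ^ a := Nat.one_lt_pow (hA a (by simp)).pos.ne' (by omega)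
  rw [lcmMinus_cons, List.sum_cons, pow_add]
  refine le_trans ?_ (Nat.mul_le_mul (Nat.sub_le (q ^ a) 1) (lcmMinus_le hq hA'))
  rw [← Nat.gcd_mul_lcm (q ^ a - 1) (lcmMinus q (b :: A))]
  refine Nat.mul_le_mul_right _ (Nat.le_of_dvd (Nat.gcd_pos_of_pos_left _ (by omega))
    (Nat.dvd_gcd ?_ (dvd_trans ?_ (Nat.dvd_lcm_left (q ^ b - 1) _))))
  · simpa using Nat.sub_dvd_pow_sub_pow q 1 a
  · simpa using Nat.sub_dvd_pow_sub_pow q 1 b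

/-- Every order is either at most half of the supremum of the products of plus parts, or it is
bounded by odd minus parts and plus parts with distinct `2`-adic valuations. -/
theorem mem_orderSet_bound {m q N : ℕ} (hq : Even q) (hq2 : 2 ≤ q) (hN : N ∈ orderSet m q) :
    (1 - (q : ℝ)⁻¹) * N ≤ (q : ℝ) ^ m / 2 ∨
    ∃ (m' : ℕ) (A : List ℕ) (S : Finset ℕ) (o : ℕ → ℕ), (∀ a ∈ A, Odd a) ∧
      m' + A.sum + ∑ i ∈ S, valPart o i = m ∧
      (N : ℝ) ≤ twoPart m' * lcmMinus q A *
        ((q : ℝ) ^ (∑ i ∈ S, valPart o i) * plusRatio (q : ℝ)⁻¹ S o) := by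
  obtain ⟨m', hm', P, rfl⟩ := hN
  obtain ⟨A, B, hA, hB, hsum, hdvd⟩ := exists_odd_minus_parts hq (by omega) P.parts P.pos
  rw [P.sum_eq] at hsum
  obtain ⟨S, o, -, hS⟩ := exists_distinct_valuations hq2 B hB
  have hq0 : (0 : ℝ) < q := by positivity
  have hq2' : (2 : ℝ) ≤ q := by exact_mod_cast hq2
  have hApos := lcmMinus_pos hq2 hA
  have hBpos := lcmPlus_pos q B
  have hle : orderL m q m' P ≤ twoPart m' * lcmMinus q A * lcmPlus q B := by
    rw [orderL, SignedPartition.lcm, mul_assoc]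
    exact Nat.mul_le_mul_left _ ((Nat.le_of_dvd (Nat.lcm_pos hApos hBpos) hdvd).trans
      (Nat.lcm_le_mul hApos hBpos))
  have hle' : (orderL m q m' P : ℝ) ≤ twoPart m' * lcmMinus q A * lcmPlus q B := by
    exact_mod_cast hle
  have hpre : (0 : ℝ) ≤ twoPart m' * lcmMinus q A := by positivity
  rcases hS with ⟨hS1, hS2⟩ | hS
  · refine Or.inr ⟨m', A, S, o, hA, by omega, hle'.trans ?_⟩
    rw [hS1]
    exact mul_le_mul_of_nonneg_left hS2 hpre
  · left
    have hx1 : (q : ℝ)⁻¹ ≤ 1 := inv_le_one_of_one_le₀ (by linarith)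
    have hρ := one_sub_mul_plusRatio_le (x := (q : ℝ)⁻¹) (by positivity) hx1 o
      (S := S) (k := 0) (by simp)
    rw [pow_zero, pow_one] at hρ
    have hT : (twoPart m' : ℝ) ≤ (q : ℝ) ^ m' := by
      exact_mod_cast twoPart_le.trans (Nat.pow_le_pow_left hq2 m')
    have hAle : (lcmMinus q A : ℝ) ≤ (q : ℝ) ^ A.sum := by exact_mod_cast lcmMinus_le hq2 hA
    -- The factor q lost to a repeated valuation is at least 2, and only this half is kept.
    have hB2 : (1 - (q : ℝ)⁻¹) * lcmPlus q B ≤ (q : ℝ) ^ B.sum / 2 := by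
      have h1 : (1 - (q : ℝ)⁻¹) * lcmPlus q B * q ≤ (q : ℝ) ^ B.sum := by
        calc (1 - (q : ℝ)⁻¹) * lcmPlus q B * q = (1 - (q : ℝ)⁻¹) * (lcmPlus q B * q) := by ring
          _ ≤ (1 - (q : ℝ)⁻¹) * ((q : ℝ) ^ B.sum * plusRatio (q : ℝ)⁻¹ S o) :=
            mul_le_mul_of_nonneg_left hS (by linarith)
          _ = (q : ℝ) ^ B.sum * ((1 - (q : ℝ)⁻¹) * plusRatio (q : ℝ)⁻¹ S o) := by ring
          _ ≤ (q : ℝ) ^ B.sum * 1 := mul_le_mul_of_nonneg_left hρ (by positivity)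
          _ = (q : ℝ) ^ B.sum := mul_one _
      have h2 : 0 ≤ (1 - (q : ℝ)⁻¹) * lcmPlus q B :=
        mul_nonneg (by linarith) (by positivity)
      nlinarith
    have hm : (q : ℝ) ^ m = (q : ℝ) ^ m' * (q : ℝ) ^ A.sum * (q : ℝ) ^ B.sum := by
      rw [← pow_add, ← pow_add]; congr 1; omega
    calc (1 - (q : ℝ)⁻¹) * orderL m q m' P
        ≤ (1 - (q : ℝ)⁻¹) * (twoPart m' * lcmMinus q A * lcmPlus q B) :=
          mul_le_mul_of_nonneg_left hle' (by linarith)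
      _ = twoPart m' * lcmMinus q A * ((1 - (q : ℝ)⁻¹) * lcmPlus q B) := by ring
      _ ≤ (q : ℝ) ^ m' * (q : ℝ) ^ A.sum * ((q : ℝ) ^ B.sum / 2) := by
          refine mul_le_mul ?_ hB2 (mul_nonneg (by linarith) (by positivity)) (by positivity)
          exact mul_le_mul hT hAle (by positivity) (by positivity)
      _ = (q : ℝ) ^ m / 2 := by rw [hm]; ring

/-! ### Optimality of the binary expansion -/

theorem mem_iff_odd_of_sum_valPart {S : Finset ℕ} {o : ℕ → ℕ} {k n : ℕ} (hS : ∀ i ∈ S, k ≤ i)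
    (hsum : ∑ i ∈ S, valPart o i = 2 ^ k * n) : k ∈ S ↔ Odd n := by
  have hdvd : ∀ T : Finset ℕ, (∀ i ∈ T, k + 1 ≤ i) → 2 ^ k * 2 ∣ ∑ i ∈ T, valPart o i :=
    fun T hT => Finset.dvd_sum fun i hi => (pow_succ 2 k ▸ pow_dvd_pow 2 (hT i hi)).mul_right _
  constructor
  · intro h
    have h1 := hdvd (S.erase k) fun i hi => by
      have := hS i (Finset.mem_of_mem_erase hi)
      have := Finset.ne_of_mem_erase hi
      omega
    obtain ⟨c, hc⟩ := h1
    rw [← Finset.add_sum_erase _ _ h, hc, valPart, mul_assoc, ← mul_add] at hsum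
    have := Nat.eq_of_mul_eq_mul_left (by positivity) hsum
    exact ⟨o k + c, by omega⟩
  · intro h
    by_contra hk
    obtain ⟨c, hc⟩ := hdvd S fun i hi => by
      have := hS i hi
      have : i ≠ k := ne_of_mem_of_not_mem hi hk
      omega
    rw [hc, mul_assoc] at hsum
    have := Nat.eq_of_mul_eq_mul_left (by positivity) hsum
    exact (Nat.not_even_iff_odd.2 h) ⟨c, by omega⟩

theorem one_le_prod_one_add {x : ℝ} (hx : 0 ≤ x) (L : List ℕ) (f : ℕ → ℕ) :
    1 ≤ (L.map fun i => 1 + x ^ f i).prod := by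
  induction L with
  | nil => simp
  | cons a L ih =>
    rw [List.map_cons, List.prod_cons]
    have : 0 ≤ x ^ f a := by positivity
    nlinarith

/-- Among the families of plus parts with distinct valuations and given sum, the binary expansion
gives the largest product. -/
theorem plusRatio_le_prod_bitIndices {x : ℝ} (hx : 0 ≤ x) (hx2 : x ≤ 1 / 2) {o : ℕ → ℕ} (n : ℕ)
    {k : ℕ} {S : Finset ℕ} (hS : ∀ i ∈ S, k ≤ i) (hsum : ∑ i ∈ S, valPart o i = 2 ^ k * n) :
    plusRatio x S o ≤ (n.bitIndices.map fun i => 1 + x ^ 2 ^ (k + i)).prod := by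
  have hx1 : x ≤ 1 := by linarith
  induction n using Nat.strong_induction_on generalizing k S with
  | _ n ih =>
    have hk := mem_iff_odd_of_sum_valPart hS hsum
    have hshift : ∀ c : ℕ, ((c.bitIndices.map (· + 1)).map fun i => 1 + x ^ 2 ^ (k + i)).prod
        = (c.bitIndices.map fun i => 1 + x ^ 2 ^ (k + 1 + i)).prod := by
      intro c
      rw [List.map_map]
      congr 2
      funext i
      simp only [Function.comp_apply]
      rw [show k + (i + 1) = k + 1 + i by ring]
    rcases Nat.even_or_odd' n with ⟨c, rfl | rfl⟩
    · rcases Nat.eq_zero_or_pos c with rfl | hc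
      · have : S = ∅ := Finset.eq_empty_of_forall_notMem fun i hi => by
          have h := Finset.single_le_sum (f := valPart o) (fun _ _ => Nat.zero_le _) hi
          have := valPart_pos o i
          omega
        simp [this, plusRatio]
      · have hkS : k ∉ S := fun h => by
          have := hk.1 h
          rw [Nat.odd_iff] at this; omega
        have h := ih c (by omega) (k := k + 1) (S := S) (fun i hi => by
          have := hS i hi
          have : i ≠ k := ne_of_mem_of_not_mem hi hkS
          omega) (by rw [hsum, pow_succ]; ring)
        rwa [Nat.bitIndices_two_mul, hshift]
    · have hkS : k ∈ S := hk.2 ⟨c, rfl⟩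
      have hy0 : 0 ≤ x ^ 2 ^ k := by positivity
      rw [Nat.bitIndices_two_mul_add_one, List.map_cons, List.prod_cons, hshift, add_zero]
      by_cases hok : o k = 0
      · rw [plusRatio_eq_mul_erase hkS, valPart_of_eq_zero hok]
        refine mul_le_mul_of_nonneg_left (ih c (by omega) (fun i hi => ?_) ?_) (by positivity)
        · have := hS i (Finset.mem_of_mem_erase hi)
          have := Finset.ne_of_mem_erase hi
          omega
        · rw [← Finset.add_sum_erase _ _ hkS, valPart_of_eq_zero hok] at hsum
          rw [pow_succ]
          linarith
      -- If the part of valuation k is not 2^k, the whole product is already at most 1 + y, the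
      -- first binary factor: 1 + y^3 ≤ (1 - y^2)(1 + y) amounts to y (1 + y)(1 - 2y) ≥ 0. This is
      -- where x ≤ 1/2 enters.
      · have h := one_sub_sq_mul_plusRatio_le hx hx1 hS fun _ => hok
        have hy2 : x ^ 2 ^ k ≤ 1 / 2 :=
          (pow_le_of_le_one hx hx1 (by positivity)).trans hx2
        have hP := one_le_prod_one_add hx c.bitIndices fun i => 2 ^ (k + 1 + i)
        have hle : plusRatio x S o ≤ 1 + x ^ 2 ^ k := by
          refine le_of_mul_le_mul_left (a := 1 - (x ^ 2 ^ k) ^ 2) ?_ (by nlinarith)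
          nlinarith [mul_nonneg hy0 (mul_nonneg (sub_nonneg.2 hy2) (by positivity :
            0 ≤ 1 + x ^ 2 ^ k))]
        exact hle.trans (le_mul_of_one_le_right (by positivity) hP)

/-! ### The case q ≥ 4 -/

theorem cast_pow_sub_one {q : ℕ} (hq : 1 ≤ q) (a : ℕ) :
    ((q ^ a - 1 : ℕ) : ℝ) = (q : ℝ) ^ a * (1 - (q : ℝ)⁻¹ ^ a) := by
  have hq0 : (q : ℝ) ≠ 0 := by positivity
  rw [Nat.cast_sub (Nat.one_le_pow _ _ hq), mul_sub, ← mul_pow, mul_inv_cancel₀ hq0]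
  push_cast
  ring

theorem cast_fermatProd {q : ℕ} (hq : 1 ≤ q) (L : List ℕ) :
    (fermatProd q L : ℝ)
      = (q : ℝ) ^ (L.map fun i => 2 ^ i).sum * (L.map fun i => 1 + (q : ℝ)⁻¹ ^ 2 ^ i).prod := by
  have hq0 : (q : ℝ) ≠ 0 := by positivity
  induction L with
  | nil => simp [fermatProd]
  | cons a L ih =>
    have h : fermatProd q (a :: L) = (q ^ 2 ^ a + 1) * fermatProd q L := rfl
    have e : (q : ℝ) ^ 2 ^ a * (q : ℝ)⁻¹ ^ 2 ^ a = 1 := by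
      rw [← mul_pow, mul_inv_cancel₀ hq0, one_pow]
    rw [h, Nat.cast_mul, ih, List.map_cons, List.map_cons, List.sum_cons, List.prod_cons, pow_add]
    push_cast
    linear_combination -(q : ℝ) ^ (L.map fun i => 2 ^ i).sum *
      (L.map fun i => 1 + (q : ℝ)⁻¹ ^ 2 ^ i).prod * e

/-- For `q ≥ 4` at most one odd minus part and no power of two occur in a large order. -/
theorem mem_orderSet_bound_of_four_le {m q N : ℕ} (hq : Even q) (hq4 : 4 ≤ q)
    (hN : N ∈ orderSet m q) :
    (1 - (q : ℝ)⁻¹) * N ≤ (q : ℝ) ^ m / 2 ∨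
    ∃ (S : Finset ℕ) (o : ℕ → ℕ),
      (∑ i ∈ S, valPart o i = m ∧ (N : ℝ) ≤ (q : ℝ) ^ m * plusRatio (q : ℝ)⁻¹ S o) ∨
      ∃ a : ℕ, Odd a ∧ a + ∑ i ∈ S, valPart o i = m ∧
        (N : ℝ) ≤ (q : ℝ) ^ m * ((1 - (q : ℝ)⁻¹ ^ a) * plusRatio (q : ℝ)⁻¹ S o) := by
  rcases mem_orderSet_bound hq (by omega) hN with h | ⟨m', A, S, o, hA, hsum, hle⟩
  · exact Or.inl h
  have hq0 : (0 : ℝ) < q := by positivity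
  have hq4' : (4 : ℝ) ≤ q := by exact_mod_cast hq4
  have hx0 : (0 : ℝ) ≤ (q : ℝ)⁻¹ := by positivity
  have hx1 : (q : ℝ)⁻¹ ≤ 1 := inv_le_one_of_one_le₀ (by linarith)
  have hρ := one_sub_mul_plusRatio_le (x := (q : ℝ)⁻¹) hx0 hx1 o (S := S) (k := 0) (by simp)
  rw [pow_zero, pow_one] at hρ
  have hA1 : (lcmMinus q A : ℝ) ≤ (q : ℝ) ^ A.sum := by
    exact_mod_cast lcmMinus_le (by omega) hA
  have hm : (q : ℝ) ^ m = (q : ℝ) ^ m' * (q : ℝ) ^ A.sum * (q : ℝ) ^ (∑ i ∈ S, valPart o i) := by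
    rw [← pow_add, ← pow_add, hsum]
  have hloss : (twoPart m' * lcmMinus q A : ℝ) ≤ (q : ℝ) ^ m' * (q : ℝ) ^ A.sum / 2 →
      (1 - (q : ℝ)⁻¹) * N ≤ (q : ℝ) ^ m / 2 := by
    intro h
    calc (1 - (q : ℝ)⁻¹) * N
        ≤ (1 - (q : ℝ)⁻¹) * (twoPart m' * lcmMinus q A *
          ((q : ℝ) ^ (∑ i ∈ S, valPart o i) * plusRatio (q : ℝ)⁻¹ S o)) :=
          mul_le_mul_of_nonneg_left hle (by linarith)
      _ = twoPart m' * lcmMinus q A * (q : ℝ) ^ (∑ i ∈ S, valPart o i) *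
          ((1 - (q : ℝ)⁻¹) * plusRatio (q : ℝ)⁻¹ S o) := by ring
      _ ≤ twoPart m' * lcmMinus q A * (q : ℝ) ^ (∑ i ∈ S, valPart o i) * 1 :=
          mul_le_mul_of_nonneg_left hρ (by positivity)
      _ ≤ (q : ℝ) ^ m' * (q : ℝ) ^ A.sum / 2 * (q : ℝ) ^ (∑ i ∈ S, valPart o i) := by
          rw [mul_one]
          exact mul_le_mul_of_nonneg_right h (by positivity)
      _ = (q : ℝ) ^ m / 2 := by rw [hm]; ring
  rcases Nat.eq_zero_or_pos m' with rfl | hm'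
  · have ht : (twoPart 0 : ℝ) = 1 := by simp [twoPart]
    rw [ht, one_mul] at hle hloss
    rw [pow_zero, one_mul] at hm hloss
    match A, hA, hA1, hsum, hm, hloss, hle with
    | [], _, _, hsum, hm, _, hle =>
      refine Or.inr ⟨S, o, Or.inl ⟨by simpa using hsum, hle.trans (le_of_eq ?_)⟩⟩
      rw [hm]; simp [lcmMinus]
    | [a], hA, _, hsum, hm, _, hle =>
      refine Or.inr ⟨S, o, Or.inr ⟨a, hA a (by simp), by simpa using hsum, hle.trans ?_⟩⟩
      have h := lcmMinus_cons_le (by omega : 2 ≤ q) hA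
      have hρ0 := plusRatio_pos hx0 S o
      refine (mul_le_mul_of_nonneg_right h (by positivity)).trans (le_of_eq ?_)
      rw [hm]; ring
    | a :: b :: A, hA, _, _, _, hloss, _ =>
      refine Or.inl (hloss ?_)
      have h := sub_one_mul_lcmMinus_le (by omega : 2 ≤ q) hA
      have h2 : 2 * lcmMinus q (a :: b :: A) ≤ q ^ (a :: b :: A).sum :=
        (Nat.mul_le_mul_right _ (by omega)).trans h
      have h3 : (2 * lcmMinus q (a :: b :: A) : ℝ) ≤ (q : ℝ) ^ (a :: b :: A).sum := by
        exact_mod_cast h2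
      linarith
  · refine Or.inl (hloss ?_)
    have h1 : 2 * twoPart m' ≤ q ^ m' := by
      calc 2 * twoPart m' ≤ 2 ^ m' * 2 ^ m' :=
            Nat.mul_le_mul (Nat.le_self_pow hm'.ne' 2) twoPart_le
        _ = 4 ^ m' := by rw [← mul_pow]; norm_num
        _ ≤ q ^ m' := Nat.pow_le_pow_left hq4 m'
    have h2 : (2 * twoPart m' : ℝ) ≤ (q : ℝ) ^ m' := by exact_mod_cast h1
    have h3 : (twoPart m' : ℝ) ≤ (q : ℝ) ^ m' / 2 := by linarith
    calc (twoPart m' * lcmMinus q A : ℝ) ≤ (q : ℝ) ^ m' / 2 * (q : ℝ) ^ A.sum :=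
          mul_le_mul h3 hA1 (by positivity) (by positivity)
      _ = _ := by ring

theorem one_sub_inv_mul_fermatProd_range {q : ℕ} (hq : 1 ≤ q) (l : ℕ) :
    (1 - (q : ℝ)⁻¹) * fermatProd q (List.range l)
      = (q : ℝ) ^ (2 ^ l - 1) * (1 - (q : ℝ)⁻¹ ^ 2 ^ l) := by
  have hq0 : (q : ℝ) ≠ 0 := by positivity
  have h : (((q - 1) * fermatProd q (List.range l) : ℕ) : ℝ) = ((q ^ 2 ^ l - 1 : ℕ) : ℝ) := by
    rw [fermatProd_range]
  rw [cast_pow_sub_one hq, Nat.cast_mul, Nat.cast_sub hq, Nat.cast_one] at h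
  have e : (q : ℝ) ^ 2 ^ l = q * (q : ℝ) ^ (2 ^ l - 1) := by
    rw [← pow_succ', Nat.sub_add_cancel Nat.one_le_two_pow]
  rw [e] at h
  refine mul_left_cancel₀ hq0 ?_
  rw [← mul_assoc, mul_sub, mul_one, mul_inv_cancel₀ hq0, h]
  ring

/-- Here c is the measure of the candidate; c ≥ 1/2 disposes of all lossy orders, so only at most
one odd minus part next to distinct valuations has to be tested. -/
theorem mem_upperBounds_of_four_le {m q M : ℕ} {c : ℝ} (hq : Even q) (hq4 : 4 ≤ q)
    (hc : 1 / 2 ≤ c) (hM : (q : ℝ) ^ m * c ≤ (1 - (q : ℝ)⁻¹) * M)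
    (h1 : ∀ S o, ∑ i ∈ S, valPart o i = m → (1 - (q : ℝ)⁻¹) * plusRatio (q : ℝ)⁻¹ S o ≤ c)
    (h2 : ∀ S o a, Odd a → a + ∑ i ∈ S, valPart o i = m →
      (1 - (q : ℝ)⁻¹ ^ a) * ((1 - (q : ℝ)⁻¹) * plusRatio (q : ℝ)⁻¹ S o) ≤ c) :
    M ∈ upperBounds (orderSet m q) := by
  intro N hN
  have hq4' : (4 : ℝ) ≤ q := by exact_mod_cast hq4
  have hx1 : (q : ℝ)⁻¹ < 1 := inv_lt_one_of_one_lt₀ (by linarith)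
  have key : (1 - (q : ℝ)⁻¹) * N ≤ (q : ℝ) ^ m * c := by
    have hqm : (0 : ℝ) ≤ (q : ℝ) ^ m := by positivity
    rcases mem_orderSet_bound_of_four_le hq hq4 hN with h | ⟨S, o, ⟨hs, h⟩ | ⟨a, ha, hs, h⟩⟩
    · exact h.trans (by nlinarith)
    · refine (mul_le_mul_of_nonneg_left h (by linarith)).trans ?_
      rw [mul_left_comm]
      exact mul_le_mul_of_nonneg_left (h1 S o hs) hqm
    · refine (mul_le_mul_of_nonneg_left h (by linarith)).trans ?_
      rw [mul_left_comm, mul_left_comm (1 - (q : ℝ)⁻¹)]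
      exact mul_le_mul_of_nonneg_left (h2 S o a ha hs) hqm
  exact_mod_cast le_of_mul_le_mul_left (key.trans hM) (by linarith)

theorem inv_le_quarter {q : ℕ} (hq4 : 4 ≤ q) : (q : ℝ)⁻¹ ≤ 1 / 4 := by
  have hq4' : (4 : ℝ) ≤ q := by exact_mod_cast hq4
  rw [one_div]
  exact inv_anti₀ (by norm_num) hq4'

theorem isGreatest_fermatProd_bitIndices {m q : ℕ} (hq : Even q) (hq4 : 4 ≤ q) (hm : Odd m) :
    IsGreatest (orderSet m q) (fermatProd q m.bitIndices) := by
  have hx0 : (0 : ℝ) ≤ (q : ℝ)⁻¹ := by positivity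
  have hx4 := inv_le_quarter hq4
  set x := (q : ℝ)⁻¹ with hx
  constructor
  · have h := plus_mem_orderSet (m' := 0) hq (Nat.bitIndices_nodup (n := m))
      (by rw [zero_add, Nat.sum_map_two_pow_bitIndices])
    simpa [twoPart] using h
  · have hP : 1 + x ≤ (m.bitIndices.map fun i => 1 + x ^ 2 ^ i).prod := by
      obtain ⟨c, rfl⟩ := hm
      rw [Nat.bitIndices_two_mul_add_one, List.map_cons, List.prod_cons, pow_zero, pow_one]
      exact le_mul_of_one_le_right (by positivity)
        (one_le_prod_one_add hx0 _ fun i => 2 ^ i)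
    have hc : (1 - x) * (1 + x) ≤ (1 - x) * (m.bitIndices.map fun i => 1 + x ^ 2 ^ i).prod :=
      mul_le_mul_of_nonneg_left hP (by linarith)
    refine mem_upperBounds_of_four_le hq hq4 (le_trans ?_ hc) (le_of_eq ?_) ?_ ?_
    · nlinarith
    · rw [cast_fermatProd (by omega), Nat.sum_map_two_pow_bitIndices, ← hx]
      ring
    · intro S o hs
      have h := plusRatio_le_prod_bitIndices hx0 (by linarith) m (o := o) (k := 0) (S := S)
        (by simp) (by simpa using hs)
      simp only [zero_add] at h
      exact mul_le_mul_of_nonneg_left h (by linarith)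
    · intro S o a ha hs
      -- With m odd, an odd minus part leaves an even sum, so no odd plus part: the measure is at
      -- most 1 - x + x^2 ≤ 1 - x^2 = (1 - x)(1 + x).
      have h0 : 0 ∉ S := fun h => by
        have h' := ha.add_odd ((odd_sum_valPart_iff S o).2 h)
        rw [hs] at h'
        exact Nat.not_even_iff_odd.2 hm h'
      have h := one_sub_mul_plusRatio_le_of_missing hx0 (by linarith) (o := o) (S := S) (k := 0)
        (by simp) (fun h => absurd h h0)
      rw [pow_zero, pow_one] at h
      have hρ := plusRatio_pos hx0 S o
      have hρ' : 0 ≤ (1 - x) * plusRatio x S o := mul_nonneg (by linarith) hρ.le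
      have hxa : 0 ≤ x ^ a := by positivity
      refine le_trans ?_ hc
      nlinarith

theorem isGreatest_sq_add_one {q : ℕ} (hq : Even q) (hq4 : 4 ≤ q) :
    IsGreatest (orderSet 2 q) (q ^ 2 + 1) := by
  have hx0 : (0 : ℝ) ≤ (q : ℝ)⁻¹ := by positivity
  have hx4 := inv_le_quarter hq4
  set x := (q : ℝ)⁻¹ with hx
  have hb : Nat.bitIndices 2 = [1] := Nat.bitIndices_two_pow 1
  have hF : fermatProd q [1] = q ^ 2 + 1 := by simp [fermatProd]
  constructor
  · have h := plus_mem_orderSet (m := 2) (m' := 0) hq (S := [1]) (by simp) (by simp)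
    rwa [hF, twoPart, if_pos rfl, one_mul] at h
  · refine mem_upperBounds_of_four_le (c := (1 - x) * (1 + x ^ 2)) hq hq4 ?_ (le_of_eq ?_) ?_ ?_
    · nlinarith [sq_nonneg x]
    · rw [← hF, cast_fermatProd (by omega), ← hx]
      simp
      ring
    · intro S o hs
      have h := plusRatio_le_prod_bitIndices hx0 (by linarith) 2 (o := o) (k := 0) (S := S)
        (by simp) (by simpa using hs)
      simp only [zero_add, hb, List.map_cons, List.map_nil, List.prod_cons, List.prod_nil,
        mul_one, pow_one] at h
      exact mul_le_mul_of_nonneg_left h (by linarith)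
    · intro S o a ha hs
      have ha1 : a = 1 := by
        rcases ha with ⟨c, rfl⟩
        omega
      have h := one_sub_mul_plusRatio_le hx0 (by linarith) o (S := S) (k := 0) (by simp)
      rw [pow_zero, pow_one] at h
      rw [ha1, pow_one]
      refine mul_le_mul_of_nonneg_left (h.trans ?_) (by linarith)
      nlinarith [sq_nonneg x]

theorem one_sub_add_sq_anti {y z : ℝ} (hzy : z ≤ y) (hy : y ≤ 1 / 2) :
    1 - y + y ^ 2 ≤ 1 - z + z ^ 2 := by
  nlinarith [mul_nonneg (sub_nonneg.2 hzy) (by linarith : 0 ≤ 1 - y - z)]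

/-- Past the initial run, any further part is at least 2^(k+1), because 2^k itself is missing. -/
theorem filter_le_eq_empty_of_sum_lt {S : Finset ℕ} {o : ℕ → ℕ} {k : ℕ}
    (hk : ∀ i < k, i ∈ S ∧ o i = 0) (hk' : k ∈ S → o k ≠ 0)
    (hsum : ∑ i ∈ S, valPart o i < 2 ^ k - 1 + 2 ^ (k + 1)) : S.filter (k ≤ ·) = ∅ := by
  refine Finset.eq_empty_of_forall_notMem fun i hi => ?_
  have h1 := Finset.single_le_sum (f := valPart o) (fun _ _ => Nat.zero_le _) hi
  have h2 : 2 ^ (k + 1) ≤ valPart o i :=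
    two_pow_succ_le_valPart (Finset.mem_filter.1 hi).2 fun h => by
      rw [h]; exact hk' (h ▸ (Finset.mem_filter.1 hi).1)
  have h3 := (one_sub_mul_plusRatio_eq (x := 0) hk).2
  omega

theorem isGreatest_of_even {m q e : ℕ} (hq : Even q) (hq4 : 4 ≤ q) (hm : Even m)
    (hlo : 2 ^ (e + 1) + 2 ^ e ≤ m) (hhi : m < 2 ^ (e + 2) + 2 ^ (e + 1)) :
    IsGreatest (orderSet m q)
      ((q ^ (m - 2 ^ (e + 1) + 1) - 1) * fermatProd q (List.range (e + 1))) := by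
  have hx0 : (0 : ℝ) < (q : ℝ)⁻¹ := by positivity
  have hx4 := inv_le_quarter hq4
  have hx1 : (q : ℝ)⁻¹ ≤ 1 := by linarith
  set x := (q : ℝ)⁻¹ with hx
  have he1 : 2 ^ (e + 1) = 2 * 2 ^ e := pow_succ' 2 e
  have he2 : 2 ^ (e + 2) = 2 * 2 ^ (e + 1) := pow_succ' 2 (e + 1)
  have he0 : 1 ≤ 2 ^ e := Nat.one_le_two_pow
  obtain ⟨r, hr⟩ := hm
  set a' := m - 2 ^ (e + 1) + 1 with ha'
  have ha'odd : Odd a' := ⟨r - 2 ^ e, by omega⟩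
  constructor
  · have h := minus_plus_mem_orderSet (m := m) (m' := 0) hq (by omega) ha'odd
      (List.nodup_range (n := e + 1)) (by rw [sum_two_pow_range]; omega)
    rwa [twoPart, if_pos rfl, one_mul] at h
  · have hz0 : 0 < x ^ 2 ^ e := by positivity
    have hz4 : x ^ 2 ^ e ≤ 1 / 4 := (pow_le_of_le_one hx0.le hx1 (by positivity)).trans hx4
    have hw : x ^ 2 ^ (e + 1) = (x ^ 2 ^ e) ^ 2 := pow_two_pow_succ x e
    set z := x ^ 2 ^ e with hz
    have hxa' : x ^ a' ≤ z / 4 := by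
      calc x ^ a' ≤ x ^ (2 ^ e + 1) := pow_le_pow_of_le_one hx0.le hx1 (by omega)
        _ = z * x := pow_succ _ _
        _ ≤ z / 4 := by nlinarith
    have hxa'0 : 0 < x ^ a' := by positivity
    have hz2 : z ^ 2 ≤ 1 / 16 := by nlinarith
    have hsmall : 1 - z + z ^ 2 ≤ (1 - x ^ a') * (1 - z ^ 2) := by
      nlinarith [sq_nonneg z]
    -- A run stopping at k ≤ e has measure at most 1 - z + z^2, already below the candidate.
    have hlt : ∀ (S : Finset ℕ) (o : ℕ → ℕ) (k : ℕ), k ≤ e → (∀ i < k, i ∈ S ∧ o i = 0) →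
        (k ∈ S → o k ≠ 0) → (1 - x) * plusRatio x S o ≤ (1 - x ^ a') * (1 - z ^ 2) := by
      intro S o k hke hk hk'
      refine (one_sub_mul_plusRatio_le_of_missing hx0.le (by linarith) hk hk').trans
        ((one_sub_add_sq_anti ?_ ?_).trans hsmall)
      · exact pow_le_pow_of_le_one hx0.le hx1 (Nat.pow_le_pow_right (by norm_num) hke)
      · exact (pow_le_of_le_one hx0.le hx1 (by positivity)).trans (by linarith)
    refine mem_upperBounds_of_four_le (c := (1 - x ^ a') * (1 - z ^ 2)) hq hq4 ?_ (le_of_eq ?_)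
      ?_ ?_
    · nlinarith
    · have hF := one_sub_inv_mul_fermatProd_range (q := q) (by omega) (e + 1)
      rw [Nat.cast_mul, mul_left_comm (1 - (q : ℝ)⁻¹), hF, cast_pow_sub_one (by omega), ← hx, hw,
        show m = a' + (2 ^ (e + 1) - 1) by omega, pow_add]
      ring
    · intro S o hs
      have h0 : 0 ∉ S := fun h => by
        have := (odd_sum_valPart_iff S o).2 h
        rw [hs] at this
        exact Nat.not_even_iff_odd.2 this ⟨r, hr⟩
      exact hlt S o 0 (Nat.zero_le e) (by simp) fun h => absurd h h0
    · intro S o a ha hs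
      have hxa : 0 ≤ x ^ a := by positivity
      have hxa1 : x ^ a ≤ 1 := pow_le_one₀ hx0.le hx1
      have hρ0 : 0 ≤ (1 - x) * plusRatio x S o :=
        mul_nonneg (by linarith) (plusRatio_pos hx0.le S o).le
      obtain ⟨k, hk, hk'⟩ := exists_first_missing S o
      have hsplit := one_sub_mul_plusRatio_eq (x := x) hk
      rcases lt_trichotomy k (e + 1) with hke | rfl | hke
      · exact (mul_le_of_le_one_left hρ0 (by linarith)).trans (hlt S o k (by omega) hk hk')
      · have hempty := filter_le_eq_empty_of_sum_lt hk hk' (by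
          have := ha.pos
          rw [show e + 1 + 1 = e + 2 from rfl]
          omega)
        rw [hempty] at hsplit
        simp only [plusRatio, Finset.prod_empty, Finset.sum_empty, mul_one] at hsplit
        have haa : a = a' := by omega
        rw [plusRatio, hsplit.1, haa, hw]
      -- A longer run leaves too small a minus part: a < 2^(e+1) < a', so x^a is at least 4 z^2 and
      -- z^2 at least 4 x^a', and the factor 1 - x^a alone loses too much.
      · have h2k : 2 ^ (e + 2) ≤ 2 ^ k := Nat.pow_le_pow_right (by norm_num) hke
        have hρ := one_sub_mul_plusRatio_le hx0.le hx1 o (S := S) (k := 0) (by simp)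
        rw [pow_zero, pow_one] at hρ
        have hale : a + 1 ≤ 2 ^ (e + 1) := by omega
        have hw1 : z ^ 2 ≤ x ^ a * x := by
          rw [← hw, ← pow_succ]
          exact pow_le_pow_of_le_one hx0.le hx1 hale
        have hw2 : x ^ a' ≤ z ^ 2 * x := by
          rw [← hw, ← pow_succ]
          have := ha.pos
          exact pow_le_pow_of_le_one hx0.le hx1 (by omega)
        have hw3 : z ^ 2 ≤ x ^ a / 4 := by nlinarith
        have hw4 : x ^ a' ≤ z ^ 2 / 4 := by nlinarith
        calc (1 - x ^ a) * ((1 - x) * plusRatio x S o) ≤ 1 - x ^ a :=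
              mul_le_of_le_one_right (by linarith) hρ
          _ ≤ (1 - x ^ a') * (1 - z ^ 2) := by nlinarith

theorem isGreatest_maxOrderBig {m q : ℕ} (hm : 1 ≤ m) (hq : Even q) (hq4 : 4 ≤ q) :
    IsGreatest (orderSet m q) (maxOrderBig m q) := by
  unfold maxOrderBig
  split_ifs with hodd h2
  · exact isGreatest_fermatProd_bitIndices hq hq4 hodd
  · rw [h2]; exact isGreatest_sq_add_one hq hq4
  · have heven := Nat.not_odd_iff_even.1 hodd
    have hm4 : 4 ≤ m := by
      obtain ⟨r, rfl⟩ := heven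
      omega
    have hspec := Nat.findGreatest_spec (P := fun l => 1 ≤ l ∧ 2 ^ l + 2 ^ (l - 1) ≤ m)
      (m := 1) (n := m) hm ⟨le_rfl, by norm_num; omega⟩
    have hmax := fun k => Nat.findGreatest_is_greatest
      (P := fun l => 1 ≤ l ∧ 2 ^ l + 2 ^ (l - 1) ≤ m) (n := m) (k := k)
    simp only
    set l := Nat.findGreatest (fun l => 1 ≤ l ∧ 2 ^ l + 2 ^ (l - 1) ≤ m) m with hl
    obtain ⟨e, he⟩ : ∃ e, l = e + 1 := ⟨l - 1, by omega⟩
    rw [he] at hspec hmax ⊢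
    -- The search bound m of `Nat.findGreatest` is harmless, as n < 2^n.
    have hhi : m < 2 ^ (e + 2) + 2 ^ (e + 1) := by
      by_contra h
      have := Nat.lt_two_pow_self (n := e + 2)
      have := Nat.one_le_two_pow (n := e)
      exact hmax (e + 2) (by omega) (by omega) ⟨by omega, by simpa using h⟩
    rw [← fermatProd_range, mul_left_comm, Nat.mul_div_cancel_left _ (by omega)]
    exact isGreatest_of_even hq hq4 heven hspec.2 hhi

/-! ### The case q = 2 -/

theorem fermatProd_two_range (l : ℕ) : fermatProd 2 (List.range l) = 2 ^ 2 ^ l - 1 := by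
  simpa using fermatProd_range 2 l

/-- Let s be what the plus parts leave of m. For s ≤ 3 the power of two may use s without loss. For
s ≥ 4, either m' ≥ 4 and half is lost, or an odd minus part a ≤ s occurs. The exponent m + 1 absorbs
1 - x = 1/2. -/
theorem mem_upperBounds_two {m M : ℕ} {c : ℝ} (hc : 1 / 2 ≤ c)
    (hM : (2 : ℝ) ^ (m + 1) * c ≤ M)
    (h1 : ∀ (S : Finset ℕ) (o : ℕ → ℕ) (s : ℕ), s ≤ 3 → s + ∑ i ∈ S, valPart o i = m →
      (1 - (2 : ℝ)⁻¹) * plusRatio (2 : ℝ)⁻¹ S o ≤ c)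
    (h2 : ∀ (S : Finset ℕ) (o : ℕ → ℕ) (a s : ℕ), Odd a → a ≤ s → 4 ≤ s →
      s + ∑ i ∈ S, valPart o i = m →
      (1 - (2 : ℝ)⁻¹ ^ a) * ((1 - (2 : ℝ)⁻¹) * plusRatio (2 : ℝ)⁻¹ S o) ≤ c) :
    M ∈ upperBounds (orderSet m 2) := by
  intro N hN
  have key : (1 - (2 : ℝ)⁻¹) * N ≤ (2 : ℝ) ^ m * c := by
    have hqm : (0 : ℝ) ≤ (2 : ℝ) ^ m := by positivity
    rcases mem_orderSet_bound even_two le_rfl hN with h | ⟨m', A, S, o, hA, hsum, hle⟩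
    · rw [Nat.cast_ofNat] at h
      exact h.trans (by nlinarith)
    rw [Nat.cast_ofNat] at hle
    have hρ0 : 0 ≤ plusRatio (2 : ℝ)⁻¹ S o := (plusRatio_pos (by norm_num) S o).le
    have hρ := one_sub_mul_plusRatio_le (x := (2 : ℝ)⁻¹) (by norm_num) (by norm_num) o (S := S)
      (k := 0) (by simp)
    rw [pow_zero, pow_one] at hρ
    have hm : (2 : ℝ) ^ m
        = (2 : ℝ) ^ m' * (2 : ℝ) ^ A.sum * (2 : ℝ) ^ (∑ i ∈ S, valPart o i) := by
      rw [← pow_add, ← pow_add, hsum]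
    have hA1 : (lcmMinus 2 A : ℝ) ≤ (2 : ℝ) ^ A.sum := by
      exact_mod_cast lcmMinus_le le_rfl hA
    have hT1 : (twoPart m' : ℝ) ≤ (2 : ℝ) ^ m' := by exact_mod_cast twoPart_le
    have hgen : ∀ t d : ℝ, 0 ≤ t →
        (twoPart m' * lcmMinus 2 A : ℝ) ≤ (2 : ℝ) ^ m' * (2 : ℝ) ^ A.sum * t →
        t * ((1 - (2 : ℝ)⁻¹) * plusRatio (2 : ℝ)⁻¹ S o) ≤ d →
        (1 - (2 : ℝ)⁻¹) * N ≤ (2 : ℝ) ^ m * d := by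
      intro t d ht h hd
      calc (1 - (2 : ℝ)⁻¹) * N
          ≤ (1 - (2 : ℝ)⁻¹) * (twoPart m' * lcmMinus 2 A *
            ((2 : ℝ) ^ (∑ i ∈ S, valPart o i) * plusRatio (2 : ℝ)⁻¹ S o)) :=
            mul_le_mul_of_nonneg_left hle (by norm_num)
        _ ≤ (1 - (2 : ℝ)⁻¹) * ((2 : ℝ) ^ m' * (2 : ℝ) ^ A.sum * t *
            ((2 : ℝ) ^ (∑ i ∈ S, valPart o i) * plusRatio (2 : ℝ)⁻¹ S o)) :=
            mul_le_mul_of_nonneg_left (mul_le_mul_of_nonneg_right h (by positivity))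
              (by norm_num)
        _ = (2 : ℝ) ^ m * (t * ((1 - (2 : ℝ)⁻¹) * plusRatio (2 : ℝ)⁻¹ S o)) := by
            rw [hm]; ring
        _ ≤ (2 : ℝ) ^ m * d := mul_le_mul_of_nonneg_left hd hqm
    by_cases hm4 : 4 ≤ m'
    · have h2T : (2 * twoPart m' : ℝ) ≤ (2 : ℝ) ^ m' := by
        exact_mod_cast two_mul_twoPart_le hm4
      refine hgen (1 / 2) c (by norm_num) ?_ (by linarith)
      calc (twoPart m' * lcmMinus 2 A : ℝ) ≤ (2 : ℝ) ^ m' / 2 * (2 : ℝ) ^ A.sum :=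
            mul_le_mul (by linarith) hA1 (by positivity) (by positivity)
        _ = _ := by ring
    · by_cases hs : m' + A.sum ≤ 3
      · refine hgen 1 c zero_le_one ?_ (by rw [one_mul]; exact h1 S o _ hs hsum)
        rw [mul_one]
        exact mul_le_mul hT1 hA1 (by positivity) (by positivity)
      · match A, hA, hsum, hs, hgen with
        | [], _, _, hs, _ => simp at hs; omega
        | a :: A, hA, hsum, hs, hgen =>
          refine hgen (1 - (2 : ℝ)⁻¹ ^ a) c ?_ ?_
            (h2 S o a _ (hA a (by simp)) ?_ (by omega) hsum)
          · exact sub_nonneg.2 (pow_le_one₀ (by norm_num) (by norm_num))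
          · have h := lcmMinus_cons_le (le_refl 2) hA
            rw [Nat.cast_ofNat] at h
            rw [mul_assoc]
            exact mul_le_mul hT1 h (by positivity) (by positivity)
          · rw [List.sum_cons]; omega
  have h2N : (N : ℝ) ≤ (2 : ℝ) ^ (m + 1) * c := by
    rw [pow_succ]
    linarith
  exact_mod_cast h2N.trans hM

theorem two_inv_pow_le_half {n : ℕ} (hn : 1 ≤ n) : (2 : ℝ)⁻¹ ^ n ≤ 1 / 2 :=
  (pow_le_of_le_one (by norm_num) (by norm_num) (by omega)).trans (by norm_num)

theorem twoPart_eq_two_pow {m' : ℕ} (h : m' ≤ 3) : twoPart m' = 2 ^ m' := by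
  refine le_antisymm twoPart_le ?_
  unfold twoPart
  split_ifs with h0
  · simp [h0]
  · have hlt : 2 ^ (m' - 1) < 2 * m' := by interval_cases m' <;> simp_all
    have := (Nat.lt_clog_iff_pow_lt one_lt_two).2 hlt
    exact Nat.pow_le_pow_right (by norm_num) (by omega)

/-- `q = 2`, with `2 ^ l - 1 ≤ m ≤ 2 ^ l + 2`. -/
theorem isGreatest_two_of_le_three {m l m₀ : ℕ} (hl : 1 ≤ l) (hm : m + 1 = 2 ^ l + m₀)
    (hlt : m₀ < 2 ^ l) (h3 : m₀ ≤ 3) :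
    IsGreatest (orderSet m 2) (2 ^ m₀ * (2 ^ 2 ^ l - 1)) := by
  obtain ⟨e, rfl⟩ : ∃ e, l = e + 1 := ⟨l - 1, by omega⟩
  have h1 : 1 ≤ 2 ^ (e + 1) := Nat.one_le_two_pow
  constructor
  · rw [← twoPart_eq_two_pow h3, ← fermatProd_two_range]
    exact plus_mem_orderSet even_two List.nodup_range (by rw [sum_two_pow_range]; omega)
  · have hz0 : (0 : ℝ) < (2 : ℝ)⁻¹ ^ 2 ^ e := by positivity
    have hz2 := two_inv_pow_le_half (n := 2 ^ e) Nat.one_le_two_pow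
    have hw := pow_two_pow_succ (2 : ℝ)⁻¹ e
    set z := (2 : ℝ)⁻¹ ^ 2 ^ e with hz
    -- The plus parts alone obey the bound, whatever fills the rest of m.
    have key : ∀ (S : Finset ℕ) (o : ℕ → ℕ), ∑ i ∈ S, valPart o i ≤ m →
        (1 - (2 : ℝ)⁻¹) * plusRatio (2 : ℝ)⁻¹ S o ≤ 1 - z ^ 2 := by
      intro S o hs
      obtain ⟨k, hk, hk'⟩ := exists_first_missing S o
      have hsplit := one_sub_mul_plusRatio_eq (x := (2 : ℝ)⁻¹) hk
      rcases lt_trichotomy k (e + 1) with hke | rfl | hke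
      · have h := one_sub_mul_plusRatio_le_of_missing (by norm_num) (by norm_num) hk hk'
          (x := (2 : ℝ)⁻¹)
        have hle : z ≤ (2 : ℝ)⁻¹ ^ 2 ^ k :=
          pow_le_pow_of_le_one (by norm_num) (by norm_num)
            (Nat.pow_le_pow_right (by norm_num) (by omega))
        have := one_sub_add_sq_anti hle (two_inv_pow_le_half Nat.one_le_two_pow)
        nlinarith
      · have hempty := filter_le_eq_empty_of_sum_lt hk hk' (by
          rw [pow_succ 2 (e + 1)]; omega)
        rw [hempty] at hsplit
        simp only [plusRatio, Finset.prod_empty, Finset.sum_empty, mul_one] at hsplit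
        rw [plusRatio, hsplit.1, hw]
      · have h2k : 2 ^ (e + 2) ≤ 2 ^ k := Nat.pow_le_pow_right (by norm_num) hke
        have he2 : 2 ^ (e + 2) = 2 * 2 ^ (e + 1) := pow_succ' 2 (e + 1)
        omega
    refine mem_upperBounds_two (c := 1 - z ^ 2) (by nlinarith) (le_of_eq ?_) ?_ ?_
    · have h := cast_pow_sub_one (q := 2) (by norm_num) (2 ^ (e + 1))
      rw [Nat.cast_ofNat, hw] at h
      rw [Nat.cast_mul, h, Nat.cast_pow, Nat.cast_ofNat, hm, pow_add]
      ring
    · intro S o s _ hs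
      exact key S o (by omega)
    · intro S o a s _ _ _ hs
      refine (mul_le_of_le_one_left ?_ ?_).trans (key S o (by omega))
      · exact mul_nonneg (by norm_num) (plusRatio_pos (by norm_num) S o).le
      · have : (0 : ℝ) ≤ (2 : ℝ)⁻¹ ^ a := by positivity
        linarith

/-- Sort by the first missing power 2^k. The sum excludes k ≥ e + 2 and leaves nothing after a run
with k = e + 1; for k = e the only possible further part is 2^(e+1); shorter runs fall under the
last bound. -/
theorem plusRatio_half_cases {S : Finset ℕ} {o : ℕ → ℕ} {e : ℕ} (he : 2 ≤ e)
    (hs : ∑ i ∈ S, valPart o i + 1 < 2 ^ (e + 2)) :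
    ((1 - (2 : ℝ)⁻¹) * plusRatio (2 : ℝ)⁻¹ S o = 1 - ((2 : ℝ)⁻¹ ^ 2 ^ e) ^ 2 ∧
      ∑ i ∈ S, valPart o i = 2 ^ (e + 1) - 1) ∨
    ((1 - (2 : ℝ)⁻¹) * plusRatio (2 : ℝ)⁻¹ S o = 1 - (2 : ℝ)⁻¹ ^ 2 ^ e ∧
      ∑ i ∈ S, valPart o i = 2 ^ e - 1) ∨
    ((1 - (2 : ℝ)⁻¹) * plusRatio (2 : ℝ)⁻¹ S o
        = (1 - (2 : ℝ)⁻¹ ^ 2 ^ e) * (1 + ((2 : ℝ)⁻¹ ^ 2 ^ e) ^ 2) ∧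
      ∑ i ∈ S, valPart o i = 2 ^ e - 1 + 2 ^ (e + 1)) ∨
    (1 - (2 : ℝ)⁻¹) * plusRatio (2 : ℝ)⁻¹ S o ≤ 1 - 3 * (2 : ℝ)⁻¹ ^ 2 ^ e := by
  have hw := pow_two_pow_succ (2 : ℝ)⁻¹ e
  have he0 : 1 ≤ 2 ^ e := Nat.one_le_two_pow
  have he1 : 2 ^ (e + 1) = 2 * 2 ^ e := pow_succ' 2 e
  have he2 : 2 ^ (e + 2) = 2 * 2 ^ (e + 1) := pow_succ' 2 (e + 1)
  obtain ⟨k, hk, hk'⟩ := exists_first_missing S o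
  have hsplit := one_sub_mul_plusRatio_eq (x := (2 : ℝ)⁻¹) hk
  rcases lt_or_ge k e with hke | hke
  · refine Or.inr (Or.inr (Or.inr ?_))
    obtain ⟨d, rfl⟩ : ∃ d, e = d + 1 := ⟨e - 1, by omega⟩
    have h := one_sub_mul_plusRatio_le_of_missing (by norm_num) (by norm_num) hk hk'
      (x := (2 : ℝ)⁻¹)
    have hle : (2 : ℝ)⁻¹ ^ 2 ^ d ≤ (2 : ℝ)⁻¹ ^ 2 ^ k :=
      pow_le_pow_of_le_one (by norm_num) (by norm_num)
        (Nat.pow_le_pow_right (by norm_num) (by omega))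
    have h' := one_sub_add_sq_anti hle (two_inv_pow_le_half Nat.one_le_two_pow)
    have hu0 : (0 : ℝ) < (2 : ℝ)⁻¹ ^ 2 ^ d := by positivity
    -- With u^2 = x^(2^e), the bound 1 - u + u^2 ≤ 1 - 3u^2 needs u ≤ 1/4, hence e ≥ 2.
    have hu : (2 : ℝ)⁻¹ ^ 2 ^ d ≤ 1 / 4 := by
      calc (2 : ℝ)⁻¹ ^ 2 ^ d ≤ (2 : ℝ)⁻¹ ^ 2 :=
            pow_le_pow_of_le_one (by norm_num) (by norm_num)
              (Nat.le_self_pow (by omega) 2)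
        _ = 1 / 4 := by norm_num
    rw [pow_two_pow_succ]
    nlinarith
  rcases hke.eq_or_lt with rfl | hke
  · refine Or.inr ?_
    rcases (S.filter (e ≤ ·)).eq_empty_or_nonempty with hempty | ⟨j, hj⟩
    · refine Or.inl ?_
      rw [hempty] at hsplit
      simpa [plusRatio] using hsplit
    · refine Or.inr (Or.inl ?_)
      have hall : ∀ i ∈ S.filter (e ≤ ·), i = e + 1 ∧ o i = 0 := by
        intro i hi
        have h1 := Finset.single_le_sum (f := valPart o) (fun _ _ => Nat.zero_le _) hi
        have hi' := Finset.mem_filter.1 hi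
        have h2 : valPart o i < 3 * 2 ^ e := by omega
        have h3 : i ≠ e := by
          rintro rfl
          have := Nat.pos_of_ne_zero (hk' hi'.1)
          have h4 : 2 ^ i * 3 ≤ valPart o i := Nat.mul_le_mul_left _ (by omega)
          omega
        have h4 : i < e + 2 := by
          by_contra h
          have h5 : 2 ^ (e + 2) ≤ 2 ^ i := Nat.pow_le_pow_right (by norm_num) (by omega)
          have := two_pow_le_valPart o i
          omega
        have h5 : i = e + 1 := by have := hi'.2; omega
        refine ⟨h5, by_contra fun h6 => ?_⟩
        have h7 : 2 ^ i * 3 ≤ valPart o i := Nat.mul_le_mul_left _ (by omega)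
        rw [h5, he1] at h7
        rw [h5] at h2
        omega
      have hS : S.filter (e ≤ ·) = {e + 1} :=
        Finset.eq_singleton_iff_unique_mem.2
          ⟨(hall j hj).1 ▸ hj, fun i hi => (hall i hi).1⟩
      have ho : valPart o (e + 1) = 2 ^ (e + 1) :=
        valPart_of_eq_zero ((hall j hj).1 ▸ (hall j hj).2)
      rw [hS, plusRatio, plusRatio, Finset.prod_singleton, Finset.sum_singleton, ho, hw] at hsplit
      exact hsplit
  rcases (Nat.succ_le_of_lt hke).eq_or_lt with h | hke
  · refine Or.inl ?_
    subst h
    have hempty := filter_le_eq_empty_of_sum_lt hk hk' (by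
      rw [Nat.succ_eq_add_one, pow_succ 2 (e + 1)]; omega)
    rw [hempty] at hsplit
    simp only [plusRatio, Finset.prod_empty, Finset.sum_empty, mul_one, add_zero] at hsplit
    rw [← hw]
    exact hsplit
  · have h2k : 2 ^ (e + 2) ≤ 2 ^ k := Nat.pow_le_pow_right (by norm_num) hke
    omega

/-- Here m₀ = m' + m₁ with m₁ the largest odd number up to m₀, so m' only corrects parity. The
hypotheses on c list the rivals: the run to 2^e or to 2^(e-1), each with the largest odd minus part
that fits; the shorter run with 2^(e+1) added, available only if m₀ ≥ 2^e; everything else. -/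
theorem mem_upperBounds_two_of_four_le {m M e m' m₁ : ℕ} {c : ℝ} (he : 2 ≤ e)
    (hm' : m' ≤ 1) (hm₁ : Odd m₁) (h4 : 4 ≤ m' + m₁) (hm : m + 1 = 2 ^ (e + 1) + (m' + m₁))
    (hlt : m' + m₁ < 2 ^ (e + 1)) (hM : (2 : ℝ) ^ (m + 1) * c ≤ M)
    (hc1 : (1 - (2 : ℝ)⁻¹ ^ m₁) * (1 - ((2 : ℝ)⁻¹ ^ 2 ^ e) ^ 2) ≤ c)
    (hc2 : (1 - (2 : ℝ)⁻¹ ^ (2 ^ e + m₁)) * (1 - (2 : ℝ)⁻¹ ^ 2 ^ e) ≤ c)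
    (hc3 : 2 ^ e ≤ m' + m₁ → (1 - (2 : ℝ)⁻¹ ^ 2 ^ e) * (1 + ((2 : ℝ)⁻¹ ^ 2 ^ e) ^ 2) ≤ c)
    (hc4 : 1 - 3 * (2 : ℝ)⁻¹ ^ 2 ^ e ≤ c) :
    M ∈ upperBounds (orderSet m 2) := by
  have he0 : 4 ≤ 2 ^ e := by
    calc 4 = 2 ^ 2 := by norm_num
      _ ≤ 2 ^ e := Nat.pow_le_pow_right (by norm_num) he
  have he1 : 2 ^ (e + 1) = 2 * 2 ^ e := pow_succ' 2 e
  have he2 : 2 ^ (e + 2) = 2 * 2 ^ (e + 1) := pow_succ' 2 (e + 1)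
  have hz0 : (0 : ℝ) < (2 : ℝ)⁻¹ ^ 2 ^ e := by positivity
  have hz : (2 : ℝ)⁻¹ ^ 2 ^ e ≤ 1 / 16 := by
    calc (2 : ℝ)⁻¹ ^ 2 ^ e ≤ (2 : ℝ)⁻¹ ^ 4 :=
          pow_le_pow_of_le_one (by norm_num) (by norm_num) he0
      _ = 1 / 16 := by norm_num
  have heven : Even (2 ^ e) := even_two.pow_of_ne_zero (by omega)
  have hanti : ∀ {a b : ℕ}, a ≤ b → (2 : ℝ)⁻¹ ^ b ≤ (2 : ℝ)⁻¹ ^ a := fun h =>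
    pow_le_pow_of_le_one (by norm_num) (by norm_num) h
  refine mem_upperBounds_two (by linarith) hM ?_ ?_
  · intro S o s hs3 hs
    rcases plusRatio_half_cases (S := S) (o := o) he (by omega) with h | h | h | h
    · omega
    · omega
    · rw [h.1]; exact hc3 (by omega)
    · exact h.trans hc4
  · intro S o a s ha has h4s hs
    have ha0 : (0 : ℝ) ≤ (2 : ℝ)⁻¹ ^ a := by positivity
    rcases plusRatio_half_cases (S := S) (o := o) he (by omega) with h | h | h | h
    · have h1 : a ≤ m₁ := by
        rcases ha with ⟨b, rfl⟩
        rcases hm₁ with ⟨b', rfl⟩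
        omega
      rw [h.1]
      refine le_trans (mul_le_mul_of_nonneg_right ?_ (by nlinarith)) hc1
      linarith [hanti h1]
    · have h1 : a ≤ 2 ^ e + m₁ := by
        rcases ha with ⟨b, rfl⟩
        rcases hm₁ with ⟨b', rfl⟩
        rcases heven with ⟨d, hd⟩
        omega
      rw [h.1]
      refine le_trans (mul_le_mul_of_nonneg_right ?_ (by linarith)) hc2
      linarith [hanti h1]
    · rw [h.1]
      refine le_trans (mul_le_of_le_one_left ?_ (by linarith)) (hc3 (by omega))
      exact mul_nonneg (by linarith) (by positivity)
    · refine le_trans (mul_le_of_le_one_left ?_ (by linarith)) (h.trans hc4)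
      exact mul_nonneg (by norm_num) (plusRatio_pos (by norm_num) S o).le

theorem cast_two_pow_sub_one (a : ℕ) :
    ((2 ^ a - 1 : ℕ) : ℝ) = (2 : ℝ) ^ a * (1 - (2 : ℝ)⁻¹ ^ a) := by
  simpa only [Nat.cast_ofNat] using cast_pow_sub_one (q := 2) (by norm_num) a

/-- `q = 2`, with `2 ^ l + 2 < m` and `m < 2 ^ l + 2 ^ (l - 1) - 1`, where `l = e + 1`. -/
theorem isGreatest_two_of_lt {m e m' m₁ : ℕ} (he : 2 ≤ e)
    (hm' : m' ≤ 1) (hm₁ : Odd m₁) (h4 : 4 ≤ m' + m₁) (hm : m + 1 = 2 ^ (e + 1) + (m' + m₁))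
    (hlt : m' + m₁ < 2 ^ e) :
    IsGreatest (orderSet m 2) (2 ^ m' * ((2 ^ (2 ^ e + m₁) - 1) * (2 ^ 2 ^ e - 1))) := by
  have he1 : 2 ^ (e + 1) = 2 * 2 ^ e := pow_succ' 2 e
  have heven : Even (2 ^ e) := even_two.pow_of_ne_zero (by omega)
  constructor
  · rw [← twoPart_eq_two_pow (hm'.trans (by norm_num)), ← fermatProd_two_range]
    exact minus_plus_mem_orderSet even_two (by norm_num) (heven.add_odd hm₁) List.nodup_range
      (by rw [sum_two_pow_range]; omega)
  · have hz0 : (0 : ℝ) < (2 : ℝ)⁻¹ ^ 2 ^ e := by positivity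
    have hw0 : (0 : ℝ) < (2 : ℝ)⁻¹ ^ m₁ := by positivity
    have hw1 : (2 : ℝ)⁻¹ ^ m₁ ≤ 1 / 2 := two_inv_pow_le_half hm₁.pos
    have hwz : 2 * (2 : ℝ)⁻¹ ^ 2 ^ e ≤ (2 : ℝ)⁻¹ ^ m₁ := by
      have h : (2 : ℝ)⁻¹ ^ 2 ^ e ≤ (2 : ℝ)⁻¹ ^ (m₁ + 1) :=
        pow_le_pow_of_le_one (by norm_num) (by norm_num) (by
          rcases hm₁ with ⟨b, rfl⟩
          rcases heven with ⟨d, hd⟩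
          omega)
      rw [pow_succ] at h
      linarith
    have hM : ((2 ^ m' * ((2 ^ (2 ^ e + m₁) - 1) * (2 ^ 2 ^ e - 1)) : ℕ) : ℝ)
        = (2 : ℝ) ^ (m + 1) *
          ((1 - (2 : ℝ)⁻¹ ^ (2 ^ e + m₁)) * (1 - (2 : ℝ)⁻¹ ^ 2 ^ e)) := by
      rw [Nat.cast_mul, Nat.cast_mul, cast_two_pow_sub_one, cast_two_pow_sub_one, Nat.cast_pow,
        Nat.cast_ofNat, show m + 1 = m' + (2 ^ e + m₁) + 2 ^ e by omega, pow_add _ _ (2 ^ e),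
        pow_add _ m']
      ring
    refine mem_upperBounds_two_of_four_le he hm' hm₁ h4 hm (by omega) hM.ge ?_ le_rfl ?_ ?_
    · rw [pow_add]
      generalize (2 : ℝ)⁻¹ ^ 2 ^ e = z at *
      generalize (2 : ℝ)⁻¹ ^ m₁ = w at *
      nlinarith [mul_pos hz0 hw0, mul_pos (mul_pos hz0 hz0) hw0, sq_nonneg z]
    · intro h; omega
    · rw [pow_add]
      generalize (2 : ℝ)⁻¹ ^ 2 ^ e = z at *
      generalize (2 : ℝ)⁻¹ ^ m₁ = w at *
      nlinarith [mul_pos hz0 hw0, mul_pos (mul_pos hz0 hz0) hw0]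

/-- `q = 2`, with `m = 2 ^ l + 2 ^ (l - 1) - 1`, where `l = e + 1`. -/
theorem isGreatest_two_of_eq {m e : ℕ} (he : 2 ≤ e) (hm : m + 1 = 2 ^ (e + 1) + 2 ^ e) :
    IsGreatest (orderSet m 2) ((2 ^ 2 ^ (e + 1) + 1) * (2 ^ 2 ^ e - 1)) := by
  have he1 : 2 ^ (e + 1) = 2 * 2 ^ e := pow_succ' 2 e
  have he0 : 4 ≤ 2 ^ e := by
    calc 4 = 2 ^ 2 := by norm_num
      _ ≤ 2 ^ e := Nat.pow_le_pow_right (by norm_num) he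
  have heven : Even (2 ^ e) := even_two.pow_of_ne_zero (by omega)
  constructor
  · have h := plus_mem_orderSet (m := m) (m' := 0) even_two (S := (e + 1) :: List.range e)
      (by simp [List.nodup_range])
      (by rw [List.map_cons, List.sum_cons, sum_two_pow_range]; omega)
    rw [twoPart, if_pos rfl, one_mul] at h
    rwa [← fermatProd_two_range]
  · have hz0 : (0 : ℝ) < (2 : ℝ)⁻¹ ^ 2 ^ e := by positivity
    have hz1 := two_inv_pow_le_half (n := 2 ^ e) (by omega)
    have hw : (2 : ℝ)⁻¹ ^ (2 ^ e - 1) = 2 * (2 : ℝ)⁻¹ ^ 2 ^ e := by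
      have h : (2 : ℝ)⁻¹ ^ 2 ^ e = (2 : ℝ)⁻¹ ^ (2 ^ e - 1) * 2⁻¹ := by
        rw [← pow_succ, Nat.sub_add_cancel (by omega)]
      rw [h]; ring
    have hM : (((2 ^ 2 ^ (e + 1) + 1) * (2 ^ 2 ^ e - 1) : ℕ) : ℝ)
        = (2 : ℝ) ^ (m + 1) *
          ((1 - (2 : ℝ)⁻¹ ^ 2 ^ e) * (1 + ((2 : ℝ)⁻¹ ^ 2 ^ e) ^ 2)) := by
      have h : (2 : ℝ) ^ 2 ^ (e + 1) * (2 : ℝ)⁻¹ ^ 2 ^ (e + 1) = 1 := by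
        rw [← mul_pow, mul_inv_cancel₀ (by norm_num), one_pow]
      rw [Nat.cast_mul, cast_two_pow_sub_one, ← pow_two_pow_succ, hm, pow_add]
      push_cast
      linear_combination -(2 : ℝ) ^ 2 ^ e * (1 - (2 : ℝ)⁻¹ ^ 2 ^ e) * h
    -- Here m₀ = 2^e is even, so it splits as 1 + (2^e - 1).
    refine mem_upperBounds_two_of_four_le (m' := 1) (m₁ := 2 ^ e - 1) he le_rfl
      (Nat.Even.sub_odd (by omega) heven odd_one) (by omega) (by omega) (by omega) hM.ge
      ?_ ?_ (fun _ => le_rfl) ?_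
    · rw [hw]
      generalize (2 : ℝ)⁻¹ ^ 2 ^ e = z at *
      nlinarith [mul_pos hz0 hz0]
    · rw [pow_add, hw]
      generalize (2 : ℝ)⁻¹ ^ 2 ^ e = z at *
      refine mul_comm (1 - z) _ ▸ mul_le_mul_of_nonneg_left ?_ (by linarith)
      nlinarith [sq_nonneg z]
    · generalize (2 : ℝ)⁻¹ ^ 2 ^ e = z at *
      nlinarith [mul_pos hz0 hz0]

/-- `q = 2`, with `2 ^ l + 2 ^ (l - 1) - 1 < m`, where `l = e + 1`. -/
theorem isGreatest_two_of_gt {m e m' m₁ : ℕ} (he : 2 ≤ e)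
    (hm' : m' ≤ 1) (hm₁ : Odd m₁) (hm : m + 1 = 2 ^ (e + 1) + (m' + m₁))
    (hgt : 2 ^ e < m' + m₁) (hlt : m' + m₁ < 2 ^ (e + 1)) :
    IsGreatest (orderSet m 2) (2 ^ m' * ((2 ^ m₁ - 1) * (2 ^ 2 ^ (e + 1) - 1))) := by
  have he1 : 2 ^ (e + 1) = 2 * 2 ^ e := pow_succ' 2 e
  have he0 : 4 ≤ 2 ^ e := by
    calc 4 = 2 ^ 2 := by norm_num
      _ ≤ 2 ^ e := Nat.pow_le_pow_right (by norm_num) he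
  have heven : Even (2 ^ e) := even_two.pow_of_ne_zero (by omega)
  constructor
  · rw [← twoPart_eq_two_pow (hm'.trans (by norm_num)), ← fermatProd_two_range]
    exact minus_plus_mem_orderSet even_two (by norm_num) hm₁ List.nodup_range
      (by rw [sum_two_pow_range]; omega)
  · have hz0 : (0 : ℝ) < (2 : ℝ)⁻¹ ^ 2 ^ e := by positivity
    have hz1 : (2 : ℝ)⁻¹ ^ 2 ^ e ≤ 1 / 16 := by
      calc (2 : ℝ)⁻¹ ^ 2 ^ e ≤ (2 : ℝ)⁻¹ ^ 4 :=
            pow_le_pow_of_le_one (by norm_num) (by norm_num) he0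
        _ = 1 / 16 := by norm_num
    have hw0 : (0 : ℝ) < (2 : ℝ)⁻¹ ^ m₁ := by positivity
    have hwz : (2 : ℝ)⁻¹ ^ m₁ ≤ (2 : ℝ)⁻¹ ^ 2 ^ e / 2 := by
      have h : (2 : ℝ)⁻¹ ^ m₁ ≤ (2 : ℝ)⁻¹ ^ (2 ^ e + 1) :=
        pow_le_pow_of_le_one (by norm_num) (by norm_num) (by
          rcases hm₁ with ⟨b, rfl⟩
          rcases heven with ⟨d, hd⟩
          omega)
      rw [pow_succ] at h
      linarith
    have hM : ((2 ^ m' * ((2 ^ m₁ - 1) * (2 ^ 2 ^ (e + 1) - 1)) : ℕ) : ℝ)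
        = (2 : ℝ) ^ (m + 1) *
          ((1 - (2 : ℝ)⁻¹ ^ m₁) * (1 - ((2 : ℝ)⁻¹ ^ 2 ^ e) ^ 2)) := by
      rw [Nat.cast_mul, Nat.cast_mul, cast_two_pow_sub_one, cast_two_pow_sub_one, Nat.cast_pow,
        Nat.cast_ofNat, ← pow_two_pow_succ, hm,
        pow_add _ (2 ^ (e + 1)), pow_add _ m']
      ring
    -- Since w ≤ z/2 and z ≤ 1/16, the candidate beats 1 - z + z^2, which in turn dominates all
    -- three rivals.
    have hbase : 1 - (2 : ℝ)⁻¹ ^ 2 ^ e + ((2 : ℝ)⁻¹ ^ 2 ^ e) ^ 2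
        ≤ (1 - (2 : ℝ)⁻¹ ^ m₁) * (1 - ((2 : ℝ)⁻¹ ^ 2 ^ e) ^ 2) := by
      generalize (2 : ℝ)⁻¹ ^ 2 ^ e = z at *
      generalize (2 : ℝ)⁻¹ ^ m₁ = w at *
      nlinarith [mul_pos (mul_pos hz0 hz0) hw0]
    refine mem_upperBounds_two_of_four_le he hm' hm₁ (by omega) hm hlt hM.ge le_rfl
      (le_trans ?_ hbase) (fun _ => le_trans ?_ hbase) (le_trans ?_ hbase)
    · rw [pow_add]
      generalize (2 : ℝ)⁻¹ ^ 2 ^ e = z at *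
      generalize (2 : ℝ)⁻¹ ^ m₁ = w at *
      nlinarith [mul_pos hz0 hw0, sq_nonneg z]
    · generalize (2 : ℝ)⁻¹ ^ 2 ^ e = z at *
      nlinarith [pow_pos hz0 3]
    · generalize (2 : ℝ)⁻¹ ^ 2 ^ e = z at *
      nlinarith [sq_nonneg z]

theorem isGreatest_maxOrderTwo {m : ℕ} (hm : 1 ≤ m) :
    IsGreatest (orderSet m 2) (maxOrderTwo m) := by
  have hspec := Nat.findGreatest_spec (P := fun l => 1 ≤ l ∧ 2 ^ l - 1 ≤ m)
    (m := 1) (n := m) hm ⟨le_rfl, by norm_num; omega⟩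
  have hmax := fun k => Nat.findGreatest_is_greatest
    (P := fun l => 1 ≤ l ∧ 2 ^ l - 1 ≤ m) (n := m) (k := k)
  unfold maxOrderTwo
  simp only
  set l := Nat.findGreatest (fun l => 1 ≤ l ∧ 2 ^ l - 1 ≤ m) m with hl
  obtain ⟨e, he⟩ : ∃ e, l = e + 1 := ⟨l - 1, by omega⟩
  rw [he] at hspec hmax ⊢
  rw [Nat.add_sub_cancel]
  have he0 : 1 ≤ 2 ^ e := Nat.one_le_two_pow
  have he1 : 2 ^ (e + 1) = 2 * 2 ^ e := pow_succ' 2 e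
  have he2 : 2 ^ (e + 2) = 2 * 2 ^ (e + 1) := pow_succ' 2 (e + 1)
  have hhi : m < 2 ^ (e + 2) - 1 := by
    by_contra h
    have := Nat.lt_two_pow_self (n := e + 1)
    exact hmax (e + 2) (by omega) (by omega) ⟨by omega, by omega⟩
  have hlo := hspec.2
  obtain ⟨m₀, hm₀⟩ : ∃ m₀, m - (2 ^ (e + 1) - 1) = m₀ := ⟨_, rfl⟩
  rw [hm₀]
  have hmeq : m + 1 = 2 ^ (e + 1) + m₀ := by omega
  by_cases h3 : m₀ ≤ 3
  · rw [if_pos h3]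
    exact isGreatest_two_of_le_three (by omega) hmeq (by omega) h3
  -- For e ≤ 1 one would have m₀ < 2^(e+1) ≤ 4.
  have he' : 2 ≤ e := by
    by_contra h
    have : 2 ^ e ≤ 2 ^ 1 := Nat.pow_le_pow_right (by norm_num) (by omega)
    omega
  rw [if_neg h3]
  have hsub : ¬Odd m₀ → Odd (m₀ - 1) := fun h => by
    rcases Nat.not_odd_iff_even.1 h with ⟨r, hr⟩
    exact ⟨r - 1, by omega⟩
  split_ifs with hlt hodd heq hodd
  · simpa using isGreatest_two_of_lt (m' := 0) he' (by omega) hodd (by omega)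
      (by omega) (by omega)
  · have h := isGreatest_two_of_lt (m := m) (m' := 1) he' le_rfl (hsub hodd) (by omega)
      (by omega) (by omega)
    rwa [pow_one, ← mul_assoc, ← Nat.add_sub_assoc (by omega)] at h
  · exact isGreatest_two_of_eq he' (heq ▸ hmeq)
  · simpa using isGreatest_two_of_gt (m' := 0) he' (by omega) hodd (by omega)
      (by omega) (by omega)
  · have h := isGreatest_two_of_gt (m := m) (m' := 1) he' le_rfl (hsub hodd) (by omega)
      (by omega) (by omega)
    rwa [pow_one, ← mul_assoc] at h

theorem theorem2p1 (m q : ℕ) (hm : 1 ≤ m) (hq : ∃ f : ℕ, 1 ≤ f ∧ q = 2 ^ f) :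
    IsGreatest
      {N : ℕ | ∃ m' : ℕ, m' ≤ m ∧ ∃ P : SignedPartition (m - m'), N = orderL m q m' P}
      (maxOrder m q) := by
  obtain ⟨f, hf, rfl⟩ := hq
  unfold maxOrder
  split_ifs with h
  · rw [h]
    exact isGreatest_maxOrderTwo hm
  · have hf2 : 2 ≤ f := by
      rcases hf.eq_or_lt with rfl | hf
      · exact absurd (pow_one 2) h
      · exact hf
    refine isGreatest_maxOrderBig hm (even_two.pow_of_ne_zero (by omega)) ?_
    calc 4 = 2 ^ 2 := by norm_num
      _ ≤ 2 ^ f := Nat.pow_le_pow_right (by norm_num) hf2
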